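/- **Setting.** Let $(X,Y,A)$ be random variables on a probability space, with $X\in\mathcal X\subseteq\mathbb R^d$ ($\mathcal X$ Borel), $Y\in\mathbb R$, $A\in\{0,1\}$ and $\mathbb P[A=a]>0$ for $a=0,1$, and let $(\hat X_i,\hat Y_i,\hat A_i)$, $i\in\mathbb N$, be i.i.d. with the distribution of $(X,Y,A)$. Let $\Theta\subseteq\mathbb R^m$ be open, and let $h_\theta:\mathcal X\to\mathbb R$, $\theta\in\Theta$, be such that $h_\theta(x)$ is Lipschitz in $x$ for every fixed $\theta$ and Lipschitz in $\theta$ for every fixed $x$. Let $L:\mathbb R\times\mathbb R\to[0,\infty)$ be lower semicontinuous, and convex in its first argument, and let $K:\mathbb R\times\mathbb R\to\mathbb R$ be a symmetric positive definite kernel (all Gram matrices are positive semidefinite), with the maximum mean discrepancy $$d_{\rm MMD}(\mathbb Q_1,\mathbb Q_2)=\Big(\int K\,d(\mathbb Q_1\otimes\mathbb Q_1)+\int K\,d(\mathbb Q_2\otimes\mathbb Q_2)-2\int K\,d(\mathbb Q_1\otimes\mathbb Q_2)\Big)^{1/2}.$$ Let $\lambda\ge 0$ and consider the fair-learning objective $$F(\theta)=\mathbb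 E[L(h_\theta(X),Y)]+\lambda\, d_{\rm MMD}^2\big(\mathbb P_{h_\theta(X)|A=0},\mathbb P_{h_\theta(X)|A=1}\big),$$ where for every $\theta\in\Theta$ the expected loss is finite and $K$ is integrable with respect to $\mathbb P_{h_\theta(X)|A=a}\otimes\mathbb P_{h_\theta(X)|A=a'}$ for all $a,a'\in\{0,1\}$. **Batches.** Let $\bar N\ge 4$ be the target batch size. Set $\tau_1=1$ and let $\tau_{b+1}$ be the smallest integer with $\tau_{b+1}-\tau_b\ge\bar N$ such that $\mathcal I_b=\{\tau_b,\dots,\tau_{b+1}-1\}$ contains the indices of at least two samples of each class. Let $\mathcal I_b^a=\{i\in\mathcal I_b:\hat A_i=a\}$ and $$\Delta(N,n)=\mathbf 1_{\{N=\bar N\}}+\tfrac{N}{2(N-1)}\mathbf 1_{\{N>\bar N,\,n=2\}}+\tfrac{N}{N-1}\mathbf 1_{\{N>\bar N,\,n=N-2\}},$$ $$\hat R_b(\theta)=\frac1{|\mathcal I_b|}\sum_{a\in\{0,1\}}\sum_{i\in\mathcal I_b^a}\Delta(|\mathcal I_b|,|\mathcal I_b^a|)\,L(h_\theta(\hat X_i),\hat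 Y_i),$$ $$\hat U_b(\theta)=\sum_{a\in\{0,1\}}\ \sum_{i\ne j\in\mathcal I_b^a}\frac{K(h_\theta(\hat X_i),h_\theta(\hat X_j))}{|\mathcal I_b^a|(|\mathcal I_b^a|-1)}-2\sum_{i\in\mathcal I_b^0,\,j\in\mathcal I_b^1}\frac{K(h_\theta(\hat X_i),h_\theta(\hat X_j))}{|\mathcal I_b^0||\mathcal I_b^1|}.$$ **Assumption (uniform integrability).** $K$, and $L(\cdot,y)$ for every $y$, are piecewise differentiable (that is, continuous and locally a selection of finitely many $C^1$ functions), and every $\theta\in\Theta$ has a neighborhood $\Theta_0\subseteq\Theta$ such that $$\mathbb E\Big[\sup_{\vartheta}\|\nabla_\vartheta K(h_\vartheta(\hat X_1),h_\vartheta(\hat X_2))\|_2\Big]<\infty,\qquad \mathbb E\Big[\sup_{\vartheta}\|\nabla_\vartheta L(h_\vartheta(\hat X_1),\hat Y_1)\|_2\Big]<\infty,$$ where the suprema are over those $\vartheta\in\Theta_0$ at which the respective gradient exists. **Theorem (unbiased gradient estimators).** Under these conditions, for every batch index $b$ and every $\theta\in\Theta$ at which, with probability one, $\hat R_b$ and $\hat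 U_b$ are differentiable, the estimator $\nabla_\theta\hat R_b(\theta)+\lambda\nabla_\theta\hat U_b(\theta)$ is integrable, $F$ is differentiable at $\theta$, and $$\mathbb E\big[\nabla_\theta\hat R_b(\theta)+\lambda\nabla_\theta\hat U_b(\theta)\big]=\nabla F(\theta).$$ Moreover, for Lebesgue-almost every $\theta\in\Theta$, $\hat R_b$ and $\hat U_b$ are differentiable at $\theta$ with probability one. -/

import Mathlib

open MeasureTheory ProbabilityTheory Topology

noncomputable section

/-- Piecewise differentiable functions: continuous functions that locally select among finitely
many continuously differentiable functions. -/
def PiecewiseDifferentiable {E : Type*} [NormedAddCommGroup E] [NormedSpace ℝ E]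
    (f : E → ℝ) : Prop :=
  Continuous f ∧ ∀ x : E, ∃ U : Set E, IsOpen U ∧ x ∈ U ∧
    ∃ (k : ℕ) (g : Fin k → E → ℝ),
      (∀ i, ContDiffOn ℝ 1 (g i) U) ∧ ∀ y ∈ U, ∃ i, f y = g i y

/-- Symmetric positive definite kernels on the real line, in the sense of kernel theory:
all Gram matrices are symmetric and positive semidefinite. -/
def IsPosDefKernel (K : ℝ → ℝ → ℝ) : Prop :=
  (∀ z w, K z w = K w z) ∧
    ∀ (n : ℕ) (z c : Fin n → ℝ), 0 ≤ ∑ i, ∑ j, c i * c j * K (z i) (z j)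

/-- The maximum mean discrepancy between two distributions on the real line. -/
def mmd (K : ℝ → ℝ → ℝ) (Q₁ Q₂ : Measure ℝ) : ℝ :=
  √((∫ p, K p.1 p.2 ∂(Q₁.prod Q₁)) + (∫ p, K p.1 p.2 ∂(Q₂.prod Q₂))
    - 2 * ∫ p, K p.1 p.2 ∂(Q₁.prod Q₂))

section Model

variable {Ω 𝓧 Par : Type*} [MeasurableSpace Ω]

/-- The distribution of `Z` conditional on `A = a`. -/
def groupLaw (P : Measure Ω) (A : Ω → Fin 2) (Z : Ω → ℝ) (a : Fin 2) : Measure ℝ :=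
  (P[|A ⁻¹' {a}]).map Z

/-- The objective of the fair learning problem with unfairness measure `D` (a distance between
distributions on the real line) and regularization function `ρ`. -/
def fairObjective (P : Measure Ω) (X : Ω → 𝓧) (Y : Ω → ℝ) (A : Ω → Fin 2)
    (L : ℝ → ℝ → ℝ) (D : Measure ℝ → Measure ℝ → ℝ) (ρ : ℝ → ℝ)
    (h : Par → 𝓧 → ℝ) (θ : Par) : ℝ :=
  (∫ ω, L (h θ (X ω)) (Y ω) ∂P) +
    ρ (D (groupLaw P A (fun ω => h θ (X ω)) 0) (groupLaw P A (fun ω => h θ (X ω)) 1))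

end Model

/-- The index of the first sample of the `b`-th batch, when samples and batches are numbered
from `0`: the next batch starts at the smallest index such that the current batch has at least
`Nbar` samples and at least two samples of each class. (The value `sInf ∅ = 0` occurs only on
sequences for which there is no such index.) -/
def batchStart (Nbar : ℕ) (a : ℕ → Fin 2) : ℕ → ℕ
  | 0 => 0
  | b + 1 => sInf {t : ℕ | batchStart Nbar a b + Nbar ≤ t ∧
      ∀ c : Fin 2, 2 ≤ ((Finset.Ico (batchStart Nbar a b) t).filter (fun i => a i = c)).card}

/-- The index set of the `b`-th batch. -/
def batch (Nbar : ℕ) (a : ℕ → Fin 2) (b : ℕ) : Finset ℕ :=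
  Finset.Ico (batchStart Nbar a b) (batchStart Nbar a (b + 1))

/-- The indices in the `b`-th batch that belong to class `c`. -/
def batchClass (Nbar : ℕ) (a : ℕ → Fin 2) (b : ℕ) (c : Fin 2) : Finset ℕ :=
  (batch Nbar a b).filter (fun i => a i = c)

/-- The bias correction factor `Δ(N, n)` for target batch size `Nbar`. -/
def biasCorrection (Nbar N n : ℕ) : ℝ :=
  (if N = Nbar then 1 else 0)
    + (N : ℝ) / (2 * ((N : ℝ) - 1)) * (if Nbar < N ∧ n = 2 then 1 else 0)
    + (N : ℝ) / ((N : ℝ) - 1) * (if Nbar < N ∧ n + 2 = N then 1 else 0)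

section Estimators

variable {𝓧 Par : Type*}

/-- The corrected empirical prediction loss of the `b`-th batch, as a function of the parameter,
for the sample stream `(x i, y i, a i)`. -/
def batchRisk (Nbar : ℕ) (L : ℝ → ℝ → ℝ) (h : Par → 𝓧 → ℝ)
    (x : ℕ → 𝓧) (y : ℕ → ℝ) (a : ℕ → Fin 2) (b : ℕ) (θ : Par) : ℝ :=
  1 / ((batch Nbar a b).card : ℝ) *
    ∑ c : Fin 2, ∑ i ∈ batchClass Nbar a b c,
      biasCorrection Nbar (batch Nbar a b).card (batchClass Nbar a b c).card *
        L (h θ (x i)) (y i)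

/-- The U-statistic of the `b`-th batch for the squared MMD, as a function of the parameter. -/
def batchUnfairness (Nbar : ℕ) (K : ℝ → ℝ → ℝ) (h : Par → 𝓧 → ℝ)
    (x : ℕ → 𝓧) (a : ℕ → Fin 2) (b : ℕ) (θ : Par) : ℝ :=
  (∑ c : Fin 2, ∑ i ∈ batchClass Nbar a b c, ∑ j ∈ (batchClass Nbar a b c).erase i,
      K (h θ (x i)) (h θ (x j)) /
        (((batchClass Nbar a b c).card : ℝ) * (((batchClass Nbar a b c).card : ℝ) - 1)))
    - 2 * ∑ i ∈ batchClass Nbar a b 0, ∑ j ∈ batchClass Nbar a b 1,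
        K (h θ (x i)) (h θ (x j)) /
          (((batchClass Nbar a b 0).card : ℝ) * ((batchClass Nbar a b 1).card : ℝ))

end Estimators

/-- The supremum of `‖∇f‖` over the points of `S` at which the gradient exists. -/
def supGradient {m : ℕ} (f : EuclideanSpace ℝ (Fin m) → ℝ)
    (S : Set (EuclideanSpace ℝ (Fin m))) : ENNReal :=
  ⨆ θ ∈ {θ ∈ S | DifferentiableAt ℝ f θ}, ‖gradient f θ‖ₑ

/-- The uniform integrability assumption on the gradients of the loss and of the kernel, for
independent training samples `(X₁, Y₁)` and `(X₂, Y₂)`. -/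
def UniformGradientIntegrability {Ω 𝓧 : Type*} [MeasurableSpace Ω] {m : ℕ} (P : Measure Ω)
    (Θ : Set (EuclideanSpace ℝ (Fin m))) (h : EuclideanSpace ℝ (Fin m) → 𝓧 → ℝ)
    (L K : ℝ → ℝ → ℝ) (X₁ X₂ : Ω → 𝓧) (Y₁ : Ω → ℝ) : Prop :=
  (∀ y, PiecewiseDifferentiable (fun u => L u y)) ∧
  PiecewiseDifferentiable (fun p : ℝ × ℝ => K p.1 p.2) ∧
  ∀ θ ∈ Θ, ∃ Θ₀ ∈ 𝓝 θ, Θ₀ ⊆ Θ ∧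
    (∫⁻ ω, supGradient (fun ϑ => K (h ϑ (X₁ ω)) (h ϑ (X₂ ω))) Θ₀ ∂P) < ⊤ ∧
    (∫⁻ ω, supGradient (fun ϑ => L (h ϑ (X₁ ω)) (Y₁ ω)) Θ₀ ∂P) < ⊤

end

/-!
The proof has a deterministic, a probabilistic and an analytic part.

*Labels.* Almost surely every class recurs forever (`RecurrentLabels`), and then all batches are
well defined. On such sequences `batchStart` is a stopping time. The correction factor turns the
total weight of a class in a batch into its relative frequency in a *window*: the whole batch if
the batch has the target size, and otherwise the batch without its last sample, which is the one
that completed the scarce class (`RecurrentLabels.card_mul_biasCorrection`). Whether the window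
has a given start and end depends on the labels inside the window only through their counts, so by
exchangeability every label in the window can be replaced by the first one, whose law given the
start of the batch is that of a fresh sample. Hence the expected total weight of a class is its
probability (`lintegral_windowFrequency`).

*Samples.* Weights that depend on the labels only become independent of the samples in a finite
index set once the labels of these samples are fixed (`lintegral_labels_mul`). Corrected batch
averages are therefore unbiased for expectations (`integral_correctedMean`), and averages over
pairs of distinct samples of two classes are unbiased for the integral against the product of the
class-conditional laws (`integral_pairMean`). The radicand of the maximum mean discrepancy is
nonnegative (`IsPosDefKernel.mmd_sq`), so the expectation of the batch objective is the fair
learning objective on all of `Θ`. The same two unbiasedness statements, applied to Lipschitz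
moduli, provide the integrable bound below.

*Derivatives.* A piecewise differentiable function is locally Lipschitz, and a locally Lipschitz
function on a ball is Lipschitz with constant the supremum of its gradients over the points of
differentiability, by Rademacher's theorem and Fubini's theorem. Since that supremum need not be
measurable in the sample, it is replaced by the supremum of difference quotients over a countable
dense set (`lipModulus`). Differentiation under the expectation then gives the first claim, and
Rademacher's theorem combined with Fubini's theorem gives the second (`ae_ae_differentiableAt`).
-/

noncomputable section

/-! ### Lipschitz estimates -/

/-- A continuous function whose difference quotients to the right are frequently below every `r > c`
grows by at most `c` over the unit interval. -/
theorem sub_le_of_frequently_slope_lt {φ : ℝ → ℝ} {c : ℝ} (hφ : ContinuousOn φ (Set.Icc 0 1))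
    (h : ∀ x ∈ Set.Ico (0 : ℝ) 1, ∀ r, c < r → ∃ᶠ z in 𝓝[>] x, slope φ x z < r) :
    φ 1 - φ 0 ≤ c := by
  have key := image_le_of_liminf_slope_right_le_deriv_boundary (f := φ) (a := 0) (b := 1)
    (B := fun t => φ 0 + c * t) (B' := fun _ => c) hφ (by simp) (by fun_prop)
    (fun x _ => by
      simpa using ((hasDerivWithinAt_id x (Set.Ici x)).const_mul c).const_add (φ 0)) h
    (Set.right_mem_Icc.2 zero_le_one)
  simp only [mul_one] at key
  linarith

/-- Along a segment, one of the finitely many selection functions is active arbitrarily close to the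
right of any given point, so its Lipschitz constant frequently bounds the difference quotients there. -/
theorem PiecewiseDifferentiable.locallyLipschitz {E : Type*} [NormedAddCommGroup E]
    [NormedSpace ℝ E] {f : E → ℝ} (hf : PiecewiseDifferentiable f) : LocallyLipschitz f := by
  intro x
  obtain ⟨hc, hloc⟩ := hf
  obtain ⟨U, hU, hxU, k, g, hg, hfg⟩ := hloc x
  have h1 : ∀ i, ∃ K : NNReal, ∃ t ∈ 𝓝 x, LipschitzOnWith K (g i) t := fun i =>
    ((hg i).contDiffAt (hU.mem_nhds hxU)).exists_lipschitzOnWith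
  choose C t ht hL using h1
  have h2 : U ∩ ⋂ i, t i ∈ 𝓝 x :=
    Filter.inter_mem (hU.mem_nhds hxU) (Filter.iInter_mem.2 ht)
  obtain ⟨r, hr, hball⟩ := Metric.mem_nhds_iff.1 h2
  set M : NNReal := Finset.univ.sup C
  refine ⟨M, Metric.ball x r, Metric.ball_mem_nhds x hr, ?_⟩
  have hle : ∀ p ∈ Metric.ball x r, ∀ q ∈ Metric.ball x r, f q - f p ≤ M * dist p q := by
    intro p hp q hq
    set γ : ℝ → E := fun t => AffineMap.lineMap p q t
    have hγc : Continuous γ := AffineMap.lineMap_continuous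
    have hγ : ∀ t ∈ Set.Icc (0 : ℝ) 1, γ t ∈ Metric.ball x r := fun t ht =>
      (convex_ball x r).lineMap_mem hp hq ht
    have hdist : ∀ s t, dist (γ s) (γ t) = |s - t| * dist p q := fun s t => by
      simp only [γ, dist_lineMap_lineMap, Real.dist_eq]
    have := sub_le_of_frequently_slope_lt (φ := fun t => f (γ t)) (c := M * dist p q)
      (by fun_prop) ?_
    · simpa [γ] using this
    intro s hs r' hr'
    have hev : ∀ᶠ z in 𝓝[>] s, z ∈ Set.Ioo s 1 := Ioo_mem_nhdsGT hs.2
    -- a single selection function is active arbitrarily close to the right of `s`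
    have hex : ∃ i, ∃ᶠ z in 𝓝[>] s, f (γ z) = g i (γ z) := by
      by_contra hcon
      push Not at hcon
      have : ∀ i, ∀ᶠ z in 𝓝[>] s, f (γ z) ≠ g i (γ z) := fun i => by
        simpa [Filter.not_frequently] using hcon i
      obtain ⟨z, hz1, hz2⟩ := ((Filter.eventually_all.2 this).and hev).exists
      obtain ⟨i, hi⟩ := hfg (γ z) (hball (hγ z ⟨hs.1.trans hz2.1.le, hz2.2.le⟩)).1
      exact hz1 i hi
    obtain ⟨i, hi⟩ := hex
    have hgi : ∀ z ∈ Set.Icc (0 : ℝ) 1, ContinuousAt (fun z => g i (γ z)) z := fun z hz =>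
      ContinuousAt.comp (f := γ) (g := g i) (((hg i).continuousOn).continuousAt
        (hU.mem_nhds (hball (hγ z hz)).1)) hγc.continuousAt
    have hs' : s ∈ Set.Icc (0 : ℝ) 1 := ⟨hs.1, hs.2.le⟩
    have heq : f (γ s) = g i (γ s) := by
      have hlim : Filter.Tendsto (fun z => f (γ z) - g i (γ z)) (𝓝[>] s)
          (𝓝 (f (γ s) - g i (γ s))) :=
        (((hc.comp hγc).continuousAt.sub (hgi s hs')).tendsto).mono_left nhdsWithin_le_nhds
      have := isClosed_singleton (x := (0 : ℝ)).mem_of_frequently_of_tendsto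
        (hi.mono fun z hz => by simp [hz]) hlim
      exact sub_eq_zero.1 this
    refine (hi.and_eventually hev).mono fun z ⟨hz, hzI⟩ => lt_of_le_of_lt ?_ hr'
    have hz' : z ∈ Set.Icc (0 : ℝ) 1 := ⟨hs.1.trans hzI.1.le, hzI.2.le⟩
    have hpos : 0 < z - s := sub_pos.2 hzI.1
    rw [slope_def_field, hz, heq, div_le_iff₀ hpos]
    have h3 := (hL i).dist_le_mul _ (Set.mem_iInter.1 (hball (hγ z hz')).2 i) _
      (Set.mem_iInter.1 (hball (hγ s hs')).2 i)
    rw [hdist, abs_of_pos hpos, Real.dist_eq] at h3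
    have hCM : (C i : ℝ) ≤ M := by
      exact_mod_cast Finset.le_sup (f := C) (Finset.mem_univ i)
    calc g i (γ z) - g i (γ s) ≤ |g i (γ z) - g i (γ s)| := le_abs_self _
      _ ≤ C i * ((z - s) * dist p q) := h3
      _ ≤ M * ((z - s) * dist p q) := by gcongr
      _ = M * dist p q * (z - s) := by ring
  refine LipschitzOnWith.of_dist_le_mul fun p hp q hq => ?_
  rw [Real.dist_eq, abs_le]
  have h3 := hle p hp q hq
  have h4 := hle q hq p hp
  rw [dist_comm q p] at h4
  constructor <;> linarith

section Rademacher

variable {E : Type*} [NormedAddCommGroup E] [NormedSpace ℝ E] [FiniteDimensional ℝ E]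

/-- Almost every translate of the segment from `p` to `q` meets the set of non-differentiability in a
null set, and along it the fundamental theorem of calculus applies; the estimate passes to the segment
itself by continuity. -/
theorem LipschitzWith.abs_sub_le_of_norm_fderiv_le {f : E → ℝ} {C : NNReal}
    (hf : LipschitzWith C f) {B : Set E} (hB : IsOpen B) (hBc : Convex ℝ B) {c : ℝ}
    (hc : ∀ z ∈ B, DifferentiableAt ℝ f z → ‖fderiv ℝ f z‖ ≤ c) {p q : E} (hp : p ∈ B)
    (hq : q ∈ B) : |f q - f p| ≤ c * ‖q - p‖ := by
  borelize E
  let μ : Measure E := Measure.addHaar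
  set v := q - p
  -- almost every translate of the segment meets the exceptional null set in a null set
  have hae : ∀ᵐ z ∂μ, ∀ᵐ t : ℝ, DifferentiableAt ℝ f (p + z + t • v) := by
    have hm : MeasurableSet {w : E × ℝ | DifferentiableAt ℝ f (p + w.1 + w.2 • v)} := by
      have : Measurable fun w : E × ℝ => p + w.1 + w.2 • v := by fun_prop
      exact this (measurableSet_of_differentiableAt ℝ f)
    rw [Measure.ae_ae_comm (p := fun z t => DifferentiableAt ℝ f (p + z + t • v)) hm]
    refine Filter.Eventually.of_forall fun t => ?_
    have h1 : ∀ᵐ x ∂μ, DifferentiableAt ℝ f x := hf.ae_differentiableAt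
    have h2 := (measurePreserving_add_left μ (p + t • v)).quasiMeasurePreserving.ae h1
    filter_upwards [h2] with z hz
    convert hz using 1
    abel
  have hdense : Dense {z : E | ∀ᵐ t : ℝ, DifferentiableAt ℝ f (p + z + t • v)} :=
    Measure.dense_of_ae hae
  -- the estimate on the translated segments
  have hgood : ∀ z : E, (∀ᵐ t : ℝ, DifferentiableAt ℝ f (p + z + t • v)) → p + z ∈ B → q + z ∈ B →
      |f (q + z) - f (p + z)| ≤ c * ‖v‖ := by
    intro z hz hpz hqz
    set φ : ℝ → ℝ := fun t => f (p + z + t • v)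
    have hline : LipschitzWith ‖v‖₊ fun t : ℝ => p + z + t • v := by
      refine LipschitzWith.of_dist_le_mul fun s t => ?_
      rw [dist_add_left, dist_eq_norm, ← sub_smul, norm_smul, mul_comm, Real.dist_eq]
      rfl
    have hφ : LipschitzWith (C * ‖v‖₊) φ := hf.comp hline
    have hftc :=
      (hφ.lipschitzOnWith (s := Set.uIcc 0 1)).absolutelyContinuousOnInterval.integral_deriv_eq_sub
    have h0 : φ 0 = f (p + z) := by simp [φ]
    have h1 : φ 1 = f (q + z) := by simp only [φ, v]; congr 1; simp; abel
    rw [h0, h1] at hftc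
    rw [← hftc, ← Real.norm_eq_abs]
    have := intervalIntegral.norm_integral_le_of_norm_le_const_ae (a := (0 : ℝ)) (b := 1)
      (C := c * ‖v‖) (f := deriv φ) ?_
    · simpa using this
    filter_upwards [hz] with t ht htI
    rw [Set.uIoc_of_le zero_le_one] at htI
    have hmem : p + z + t • v ∈ B := by
      have := hBc.add_smul_sub_mem hpz hqz ⟨htI.1.le, htI.2⟩
      convert this using 3
      simp [v]
    have hd : HasDerivAt φ (fderiv ℝ f (p + z + t • v) v) t := by
      have h3 : HasDerivAt (fun t : ℝ => p + z + t • v) v t := by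
        simpa using ((hasDerivAt_id t).smul_const v).const_add (p + z)
      exact ht.hasFDerivAt.comp_hasDerivAt t h3
    rw [hd.deriv]
    exact ((fderiv ℝ f (p + z + t • v)).le_opNorm v).trans
      (by gcongr; exact hc _ hmem ht)
  have hcl : (0 : E) ∈ closure {z : E | ∀ᵐ t : ℝ, DifferentiableAt ℝ f (p + z + t • v)} :=
    hdense 0
  rw [mem_closure_iff_frequently] at hcl
  have hev : ∀ᶠ z in 𝓝 (0 : E), p + z ∈ B ∧ q + z ∈ B := by
    have hcp : ∀ x : E, Filter.Tendsto (fun z : E => x + z) (𝓝 0) (𝓝 x) := fun x => by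
      simpa using (continuous_const_add x).tendsto (0 : E)
    exact ((hcp p).eventually (hB.mem_nhds hp)).and ((hcp q).eventually (hB.mem_nhds hq))
  have hlim : Filter.Tendsto (fun z : E => |f (q + z) - f (p + z)|) (𝓝 0) (𝓝 |f q - f p|) := by
    have : Continuous fun z : E => |f (q + z) - f (p + z)| := by
      have := hf.continuous
      fun_prop
    simpa using this.tendsto 0
  exact isClosed_Iic.mem_of_frequently_of_tendsto
    ((hcl.and_eventually hev).mono fun z hz => hgood z hz.1 hz.2.1 hz.2.2) hlim

/-- On a convex open set, a locally Lipschitz function is Lipschitz with any constant that bounds its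
derivative at the points of differentiability. -/
theorem LocallyLipschitzOn.abs_sub_le_of_norm_fderiv_le {f : E → ℝ} {B : Set E} (hB : IsOpen B)
    (hBc : Convex ℝ B) (hf : LocallyLipschitzOn B f) {c : ℝ}
    (hc : ∀ z ∈ B, DifferentiableAt ℝ f z → ‖fderiv ℝ f z‖ ≤ c) {p q : E} (hp : p ∈ B)
    (hq : q ∈ B) : |f q - f p| ≤ c * ‖q - p‖ := by
  have hloc : ∀ x ∈ B, ∃ r > 0, Metric.ball x r ⊆ B ∧
      ∀ y ∈ Metric.ball x r, |f y - f x| ≤ c * ‖y - x‖ := by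
    intro x hx
    obtain ⟨K, t, ht, hK⟩ := hf hx
    rw [hB.nhdsWithin_eq hx] at ht
    obtain ⟨r, hr, hball⟩ := Metric.mem_nhds_iff.1 (Filter.inter_mem ht (hB.mem_nhds hx))
    obtain ⟨g, hg, hfg⟩ := (hK.mono (hball.trans Set.inter_subset_left)).extend_real
    refine ⟨r, hr, hball.trans Set.inter_subset_right, fun y hy => ?_⟩
    rw [hfg hy, hfg (Metric.mem_ball_self hr)]
    refine hg.abs_sub_le_of_norm_fderiv_le Metric.isOpen_ball (convex_ball x r) (fun z hz hd => ?_)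
      (Metric.mem_ball_self hr) hy
    have heq : g =ᶠ[𝓝 z] f := (hfg.symm).eventuallyEq_of_mem (Metric.isOpen_ball.mem_nhds hz)
    rw [heq.fderiv_eq]
    exact hc z (hball hz).2 (heq.differentiableAt_iff.1 hd)
  have hle : ∀ p ∈ B, ∀ q ∈ B, f q - f p ≤ c * ‖q - p‖ := by
    intro p hp q hq
    set γ : ℝ → E := fun t => AffineMap.lineMap p q t
    have hγc : Continuous γ := AffineMap.lineMap_continuous
    have hγ : ∀ t ∈ Set.Icc (0 : ℝ) 1, γ t ∈ B := fun t ht => hBc.lineMap_mem hp hq ht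
    have := sub_le_of_frequently_slope_lt (φ := fun t => f (γ t)) (c := c * ‖q - p‖)
      (hf.continuousOn.comp hγc.continuousOn hγ) ?_
    · simpa [γ] using this
    intro s hs r' hr'
    obtain ⟨r, hr, -, hfr⟩ := hloc (γ s) (hγ s ⟨hs.1, hs.2.le⟩)
    have h1 : ∀ᶠ z in 𝓝[>] s, γ z ∈ Metric.ball (γ s) r :=
      (hγc.tendsto s).mono_left nhdsWithin_le_nhds (Metric.ball_mem_nhds _ hr)
    refine Filter.Eventually.frequently ?_
    filter_upwards [h1, self_mem_nhdsWithin] with z hz hzs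
    have hpos : 0 < z - s := sub_pos.2 hzs
    refine lt_of_le_of_lt ?_ hr'
    rw [slope_def_field, div_le_iff₀ hpos]
    have h2 := (le_abs_self _).trans (hfr _ hz)
    have h3 : ‖γ z - γ s‖ = (z - s) * ‖q - p‖ := by
      rw [← dist_eq_norm, dist_lineMap_lineMap, Real.dist_eq, abs_of_pos hpos, dist_comm,
        dist_eq_norm]
    rw [h3] at h2
    linarith
  have h1 := hle p hp q hq
  have h2 := hle q hq p hp
  rw [norm_sub_rev p q] at h2
  rw [abs_le]
  constructor <;> linarith

end Rademacher

/-! ### A measurable Lipschitz modulus -/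

/-- The Lipschitz modulus of `f` on `B`, computed along a fixed countable dense sequence, so that
it depends measurably on `f`. -/
def lipModulus {E : Type*} [PseudoEMetricSpace E] [TopologicalSpace.SeparableSpace E] [Nonempty E]
    (f : E → ℝ) (B : Set E) : ENNReal :=
  ⨆ (n : ℕ) (k : ℕ) (_ : TopologicalSpace.denseSeq E n ∈ B ∧ TopologicalSpace.denseSeq E k ∈ B),
    edist (f (TopologicalSpace.denseSeq E n)) (f (TopologicalSpace.denseSeq E k)) /
      edist (TopologicalSpace.denseSeq E n) (TopologicalSpace.denseSeq E k)

theorem measurable_lipModulus {E S : Type*} [PseudoEMetricSpace E]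
    [TopologicalSpace.SeparableSpace E] [Nonempty E] [MeasurableSpace S] {f : S → E → ℝ} {B : Set E}
    (hf : ∀ p ∈ B, Measurable fun z => f z p) : Measurable fun z => lipModulus (f z) B := by
  unfold lipModulus
  refine Measurable.iSup fun n => Measurable.iSup fun k => Measurable.iSup fun h => ?_
  exact ((hf _ h.1).edist (hf _ h.2)).div_const _

/-- A finite `lipModulus` is a Lipschitz constant on the whole open set. -/
theorem edist_le_lipModulus_mul {E : Type*} [MetricSpace E] [TopologicalSpace.SeparableSpace E]
    [Nonempty E] {f : E → ℝ} {B : Set E} (hB : IsOpen B) (hf : ContinuousOn f B)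
    (hfin : lipModulus f B ≠ ⊤) {p q : E} (hp : p ∈ B) (hq : q ∈ B) :
    edist (f p) (f q) ≤ lipModulus f B * edist p q := by
  set D := Set.range (TopologicalSpace.denseSeq E)
  have hD : Dense D := TopologicalSpace.denseRange_denseSeq E
  have h1 : ∀ x ∈ B ∩ D, ∀ y ∈ B ∩ D, edist (f x) (f y) ≤ lipModulus f B * edist x y := by
    rintro x ⟨hx, n, rfl⟩ y ⟨hy, k, rfl⟩
    rcases eq_or_ne (TopologicalSpace.denseSeq E n) (TopologicalSpace.denseSeq E k) with h | h
    · simp [h]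
    rw [← ENNReal.div_le_iff (by simpa using h) (edist_ne_top _ _)]
    unfold lipModulus
    exact le_iSup_of_le n (le_iSup_of_le k (le_iSup_of_le ⟨hx, hy⟩ le_rfl))
  have h2 : LipschitzOnWith (lipModulus f B).toNNReal f (B ∩ D) := fun x hx y hy => by
    rw [ENNReal.coe_toNNReal hfin]; exact h1 x hx y hy
  have h3 : LipschitzOnWith (lipModulus f B).toNNReal f B := by
    have hBD : B ⊆ closure (B ∩ D) := hD.open_subset_closure_inter hB
    intro x hx y hy
    have : (x, y) ∈ closure ((B ∩ D) ×ˢ (B ∩ D)) := by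
      rw [closure_prod_eq]; exact ⟨hBD hx, hBD hy⟩
    have hfr := mem_closure_iff_frequently.1 this
    have hfx : ContinuousAt f x := hf.continuousAt (hB.mem_nhds hx)
    have hfy : ContinuousAt f y := hf.continuousAt (hB.mem_nhds hy)
    have hl : Filter.Tendsto (fun w : E × E => edist (f w.1) (f w.2)) (𝓝 (x, y))
        (𝓝 (edist (f x) (f y))) :=
      (hfx.tendsto.comp (continuous_fst.tendsto (x, y))).edist
        (hfy.tendsto.comp (continuous_snd.tendsto (x, y)))
    have hr : Filter.Tendsto (fun w : E × E => ((lipModulus f B).toNNReal : ENNReal) *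
        edist w.1 w.2) (𝓝 (x, y)) (𝓝 (((lipModulus f B).toNNReal : ENNReal) * edist x y)) := by
      refine ENNReal.Tendsto.const_mul ?_ (Or.inr ENNReal.coe_ne_top)
      exact (continuous_fst.edist continuous_snd).tendsto (x, y)
    exact le_of_tendsto_of_tendsto_of_frequently hl hr
      (hfr.mono fun w hw => h2 hw.1 hw.2)
  have := h3 hp hq
  rwa [ENNReal.coe_toNNReal hfin] at this

theorem lipModulus_le_supGradient {m : ℕ} {f : EuclideanSpace ℝ (Fin m) → ℝ}
    {B S : Set (EuclideanSpace ℝ (Fin m))} (hB : IsOpen B) (hBc : Convex ℝ B) (hBS : B ⊆ S)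
    (hf : LocallyLipschitzOn B f) : lipModulus f B ≤ supGradient f S := by
  rcases eq_or_ne (supGradient f S) ⊤ with htop | htop
  · simp [htop]
  have hgrad : ∀ z ∈ B, DifferentiableAt ℝ f z → ‖fderiv ℝ f z‖ ≤ (supGradient f S).toReal := by
    intro z hz hd
    have h1 : ‖gradient f z‖ₑ ≤ supGradient f S := by
      unfold supGradient
      exact le_iSup₂_of_le z ⟨hBS hz, hd⟩ le_rfl
    have h2 : ‖gradient f z‖ = ‖fderiv ℝ f z‖ := by simp [gradient]
    rw [← h2]
    have h3 := (ENNReal.toReal_le_toReal (by simp) htop).2 h1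
    simpa using h3
  unfold lipModulus
  refine iSup_le fun n => iSup_le fun k => iSup_le fun h => ?_
  refine ENNReal.div_le_of_le_mul ?_
  have h1 := hf.abs_sub_le_of_norm_fderiv_le hB hBc hgrad h.2 h.1
  rw [edist_dist, edist_dist, ← ENNReal.ofReal_toReal htop,
    ← ENNReal.ofReal_mul ENNReal.toReal_nonneg]
  refine ENNReal.ofReal_le_ofReal ?_
  rwa [Real.dist_eq, dist_eq_norm]

theorem LocallyLipschitzOn.ae_differentiableAt {E : Type*} [NormedAddCommGroup E] [NormedSpace ℝ E]
    [FiniteDimensional ℝ E] [MeasurableSpace E] [BorelSpace E] {μ : Measure E} [μ.IsAddHaarMeasure]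
    {f : E → ℝ} {Θ : Set E} (hΘ : IsOpen Θ) (hf : LocallyLipschitzOn Θ f) :
    ∀ᵐ x ∂(μ.restrict Θ), DifferentiableAt ℝ f x := by
  rw [ae_restrict_iff' hΘ.measurableSet, ae_iff]
  refine measure_null_of_locally_null _ fun x hx => ?_
  simp only [Classical.not_imp, Set.mem_ofPred_eq] at hx
  obtain ⟨K, t, ht, hK⟩ := hf hx.1
  rw [hΘ.nhdsWithin_eq hx.1] at ht
  obtain ⟨r, hr, hball⟩ := Metric.mem_nhds_iff.1 ht
  refine ⟨_, inter_mem_nhdsWithin _ (Metric.ball_mem_nhds x hr), ?_⟩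
  rw [measure_eq_zero_iff_ae_notMem]
  filter_upwards [(hK.mono hball).ae_differentiableWithinAt_of_mem (μ := μ)] with y hy hy2
  simp only [Set.mem_inter_iff, Set.mem_ofPred_eq, Classical.not_imp] at hy2
  exact hy2.1.2 ((hy hy2.2).differentiableAt (Metric.isOpen_ball.mem_nhds hy2.2))

/-! ### Measurability of derivatives of random functions -/

section

variable {E : Type*} [NormedAddCommGroup E] [NormedSpace ℝ E]

/-- Linear approximations to within `‖z‖ / (n + 1)` near `θ`, for every `n`, form a Cauchy sequence,
whose limit is the derivative. -/
theorem differentiableAt_of_approx {f : E → ℝ} {θ : E}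
    (h : ∀ n : ℕ, ∃ L : E →L[ℝ] ℝ, ∃ δ > 0, ∀ z ∈ Metric.ball (0 : E) δ,
      |f (θ + z) - f θ - L z| ≤ ‖z‖ / (n + 1)) : DifferentiableAt ℝ f θ := by
  choose L δ hδ hL using h
  have hdist : ∀ n k, ‖L n - L k‖ ≤ 1 / ((n : ℝ) + 1) + 1 / ((k : ℝ) + 1) := by
    intro n k
    refine ContinuousLinearMap.opNorm_le_of_ball (lt_min (hδ n) (hδ k)) (by positivity)
      fun z hz => ?_
    have h1 := hL n z (Metric.ball_subset_ball (min_le_left _ _) hz)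
    have h2 := hL k z (Metric.ball_subset_ball (min_le_right _ _) hz)
    rw [abs_le] at h1 h2
    rw [sub_apply, Real.norm_eq_abs, abs_le, add_mul, one_div_mul_eq_div,
      one_div_mul_eq_div]
    constructor <;> linarith [h1.1, h1.2, h2.1, h2.2]
  have hcauchy : CauchySeq L := by
    refine cauchySeq_of_le_tendsto_0 (fun N => 1 / ((N : ℝ) + 1) + 1 / ((N : ℝ) + 1)) ?_ ?_
    · intro n k N hn hk
      rw [dist_eq_norm]
      refine (hdist n k).trans ?_
      gcongr
    · simpa using (tendsto_one_div_add_atTop_nhds_zero_nat (𝕜 := ℝ)).add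
        (tendsto_one_div_add_atTop_nhds_zero_nat (𝕜 := ℝ))
  obtain ⟨L', hL'⟩ := cauchySeq_tendsto_of_complete hcauchy
  refine (?_ : HasFDerivAt f L' θ).differentiableAt
  rw [hasFDerivAt_iff_isLittleO_nhds_zero, Asymptotics.isLittleO_iff]
  intro c hc
  have hlim : Filter.Tendsto (fun n : ℕ => 1 / ((n : ℝ) + 1) + ‖L n - L'‖) Filter.atTop (𝓝 0) := by
    simpa using (tendsto_one_div_add_atTop_nhds_zero_nat (𝕜 := ℝ)).add
      (tendsto_iff_norm_sub_tendsto_zero.1 hL')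
  obtain ⟨n, hn⟩ := (hlim.eventually (gt_mem_nhds hc)).exists
  filter_upwards [Metric.ball_mem_nhds (0 : E) (hδ n)] with z hz
  have h1 := hL n z hz
  have h2 := (L n - L').le_opNorm z
  rw [sub_apply, Real.norm_eq_abs] at h2
  rw [Real.norm_eq_abs]
  calc |f (θ + z) - f θ - L' z| = |(f (θ + z) - f θ - L n z) + (L n z - L' z)| := by
        congr 1; ring
    _ ≤ ‖z‖ / (n + 1) + ‖L n - L'‖ * ‖z‖ := (abs_add_le _ _).trans (add_le_add h1 h2)
    _ = (1 / ((n : ℝ) + 1) + ‖L n - L'‖) * ‖z‖ := by ring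
    _ ≤ c * ‖z‖ := by gcongr

variable [FiniteDimensional ℝ E]

/-- Differentiability of a continuous function is decided by countably many inequalities. -/
theorem differentiableAt_iff_denseSeq {f : E → ℝ} {Θ : Set E} (hΘ : IsOpen Θ)
    (hf : ContinuousOn f Θ) {θ : E} (hθ : θ ∈ Θ) :
    DifferentiableAt ℝ f θ ↔ ∀ n : ℕ, ∃ l k : ℕ, ∀ i : ℕ,
      ‖TopologicalSpace.denseSeq E i‖ < 1 / ((k : ℝ) + 1) →
      θ + TopologicalSpace.denseSeq E i ∈ Θ →
      |f (θ + TopologicalSpace.denseSeq E i) - f θ -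
        TopologicalSpace.denseSeq (E →L[ℝ] ℝ) l (TopologicalSpace.denseSeq E i)| ≤
        ‖TopologicalSpace.denseSeq E i‖ / (n + 1) := by
  constructor
  · intro hd n
    have hn : (0 : ℝ) < 1 / (2 * ((n : ℝ) + 1)) := by positivity
    obtain ⟨l, hl⟩ := (TopologicalSpace.denseRange_denseSeq (E →L[ℝ] ℝ)).exists_dist_lt
      (fderiv ℝ f θ) hn
    have h1 := hd.hasFDerivAt
    rw [hasFDerivAt_iff_isLittleO_nhds_zero, Asymptotics.isLittleO_iff] at h1
    obtain ⟨δ, hδ, hball⟩ := Metric.mem_nhds_iff.1 (h1 hn)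
    obtain ⟨k, hk⟩ := exists_nat_one_div_lt hδ
    refine ⟨l, k, fun i hi _ => ?_⟩
    set z := TopologicalSpace.denseSeq E i
    have h2 := hball (show z ∈ Metric.ball 0 δ by simpa using hi.trans hk)
    simp only [Set.mem_ofPred_eq, Real.norm_eq_abs] at h2
    set l' := TopologicalSpace.denseSeq (E →L[ℝ] ℝ) l
    have h3 := (fderiv ℝ f θ - l').le_opNorm z
    rw [dist_eq_norm] at hl
    rw [sub_apply, Real.norm_eq_abs] at h3
    calc |f (θ + z) - f θ - l' z|
        = |(f (θ + z) - f θ - fderiv ℝ f θ z) + (fderiv ℝ f θ z - l' z)| := by congr 1; ring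
      _ ≤ 1 / (2 * ((n : ℝ) + 1)) * ‖z‖ + ‖fderiv ℝ f θ - l'‖ * ‖z‖ :=
        (abs_add_le _ _).trans (add_le_add h2 h3)
      _ ≤ 1 / (2 * ((n : ℝ) + 1)) * ‖z‖ + 1 / (2 * ((n : ℝ) + 1)) * ‖z‖ := by gcongr
      _ = ‖z‖ / (n + 1) := by field_simp; ring
  · intro h
    refine differentiableAt_of_approx fun n => ?_
    obtain ⟨l, k, hlk⟩ := h n
    obtain ⟨r, hr, hball⟩ := Metric.mem_nhds_iff.1 (hΘ.mem_nhds hθ)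
    have hk : (0 : ℝ) < 1 / ((k : ℝ) + 1) := by positivity
    set δ := min r (1 / ((k : ℝ) + 1))
    refine ⟨TopologicalSpace.denseSeq (E →L[ℝ] ℝ) l, δ, lt_min hr hk, fun z hz => ?_⟩
    set l' := TopologicalSpace.denseSeq (E →L[ℝ] ℝ) l
    have hmemΘ : ∀ w ∈ Metric.ball (0 : E) δ, θ + w ∈ Θ := fun w hw => hball (by
      rw [Metric.mem_ball, dist_eq_norm, add_sub_cancel_left]
      exact (mem_ball_zero_iff.1 hw).trans_le (min_le_left _ _))
    have hcl := (TopologicalSpace.denseRange_denseSeq E).open_subset_closure_inter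
      (Metric.isOpen_ball (x := (0 : E)) (ε := δ)) hz
    rw [mem_closure_iff_frequently] at hcl
    have hcont : ContinuousAt (fun w => f (θ + w)) z :=
      ContinuousAt.comp (f := fun w => θ + w) (g := f)
        (hf.continuousAt (hΘ.mem_nhds (hmemΘ z hz))) (by fun_prop)
    have hlim : Filter.Tendsto (fun w => |f (θ + w) - f θ - l' w|) (𝓝 z)
        (𝓝 |f (θ + z) - f θ - l' z|) :=
      ((hcont.sub continuousAt_const).sub l'.continuous.continuousAt).abs
    have hlim2 : Filter.Tendsto (fun w : E => ‖w‖ / ((n : ℝ) + 1)) (𝓝 z)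
        (𝓝 (‖z‖ / ((n : ℝ) + 1))) :=
      (continuous_norm.div_const _).tendsto z
    refine le_of_tendsto_of_tendsto_of_frequently hlim hlim2 (hcl.mono ?_)
    rintro w ⟨hw, i, rfl⟩
    exact hlk i ((mem_ball_zero_iff.1 hw).trans_le (min_le_right _ _)) (hmemΘ _ hw)

variable [MeasurableSpace E] [BorelSpace E]

/-- A random function that is locally Lipschitz in the parameter is, at almost every parameter,
almost surely differentiable: Rademacher's theorem for each realization, and Fubini's theorem. -/
theorem ae_ae_differentiableAt {Ω : Type*} [MeasurableSpace Ω] {P : Measure Ω} [SFinite P]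
    {μ : Measure E} [μ.IsAddHaarMeasure] {f : E → Ω → ℝ} {Θ : Set E} (hΘ : IsOpen Θ)
    (hfm : ∀ θ ∈ Θ, Measurable (f θ)) (hf : ∀ ω, LocallyLipschitzOn Θ fun θ => f θ ω) :
    ∀ᵐ θ ∂(μ.restrict Θ), ∀ᵐ ω ∂P, DifferentiableAt ℝ (fun θ => f θ ω) θ := by
  classical
  set F : E × Ω → ℝ := fun w => if w.1 ∈ Θ then f w.1 w.2 else 0
  have hF : Measurable F := by
    have h1 : Measurable (Function.uncurry fun (θ : Θ) ω => f θ ω) :=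
      measurable_uncurry_of_continuous_of_measurable
        (fun ω => continuousOn_iff_continuous_domRestrict.1 (hf ω).continuousOn)
        (fun θ => hfm θ θ.2)
    have hs : MeasurableSet {w : E × Ω | w.1 ∈ Θ} := measurable_fst hΘ.measurableSet
    refine measurable_of_restrict_of_restrict_compl hs ?_ ?_
    · have h2 : Measurable fun w : {w : E × Ω | w.1 ∈ Θ} => ((⟨w.1.1, w.2⟩, w.1.2) : Θ × Ω) := by
        fun_prop
      convert h1.comp h2 using 1
      ext w
      have := w.2
      simp only [Set.mem_ofPred_eq] at this
      simp [F, this, Function.uncurry]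
    · convert measurable_const (a := (0 : ℝ)) using 1
      ext w
      have := w.2
      simp only [Set.mem_compl_iff, Set.mem_ofPred_eq] at this
      simp [F, this]
  have hD : MeasurableSet {w : E × Ω | w.1 ∈ Θ → DifferentiableAt ℝ (fun θ => f θ w.2) w.1} := by
    have heq : {w : E × Ω | w.1 ∈ Θ → DifferentiableAt ℝ (fun θ => f θ w.2) w.1} =
        {w : E × Ω | w.1 ∈ Θ}ᶜ ∪ ⋂ n : ℕ, ⋃ l : ℕ, ⋃ k : ℕ, ⋂ i : ℕ,
          {w | ‖TopologicalSpace.denseSeq E i‖ < 1 / ((k : ℝ) + 1) →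
            w.1 + TopologicalSpace.denseSeq E i ∈ Θ →
            |F (w.1 + TopologicalSpace.denseSeq E i, w.2) - F w -
              TopologicalSpace.denseSeq (E →L[ℝ] ℝ) l (TopologicalSpace.denseSeq E i)| ≤
              ‖TopologicalSpace.denseSeq E i‖ / (n + 1)} := by
      ext w
      by_cases hw : w.1 ∈ Θ
      · simp only [Set.mem_ofPred_eq, hw, true_imp_iff, Set.mem_union, Set.mem_compl_iff,
          not_true_eq_false, false_or, Set.mem_iInter, Set.mem_iUnion]
        rw [differentiableAt_iff_denseSeq hΘ (hf w.2).continuousOn hw]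
        refine forall_congr' fun n => exists_congr fun l => exists_congr fun k =>
          forall_congr' fun i => imp_congr_right fun _ => imp_congr_right fun hi => ?_
        simp [F, hw, hi]
      · simp [hw]
    rw [heq]
    have hs : MeasurableSet {w : E × Ω | w.1 ∈ Θ} := measurable_fst hΘ.measurableSet
    refine hs.compl.union (MeasurableSet.iInter fun n => MeasurableSet.iUnion fun l =>
      MeasurableSet.iUnion fun k => MeasurableSet.iInter fun i => ?_)
    have h1 : Measurable fun w : E × Ω => w.1 + TopologicalSpace.denseSeq E i := by fun_prop
    refine (MeasurableSet.const _).imp ((h1 hΘ.measurableSet).imp ?_)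
    have h2 : Measurable fun w : E × Ω => F (w.1 + TopologicalSpace.denseSeq E i, w.2) :=
      hF.comp (by fun_prop)
    exact measurableSet_le (((h2.sub hF).sub_const _).abs) measurable_const
  rw [ae_restrict_iff' hΘ.measurableSet]
  have key : ∀ᵐ θ ∂μ, ∀ᵐ ω ∂P, θ ∈ Θ → DifferentiableAt ℝ (fun θ => f θ ω) θ := by
    rw [Measure.ae_ae_comm (p := fun θ ω => θ ∈ Θ → DifferentiableAt ℝ (fun θ => f θ ω) θ) hD]
    refine Filter.Eventually.of_forall fun ω => ?_
    have := (hf ω).ae_differentiableAt (μ := μ) hΘ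
    rwa [ae_restrict_iff' hΘ.measurableSet] at this
  filter_upwards [key] with θ hθ hmem
  filter_upwards [hθ] with ω hω using hω hmem

end

/-- The derivative of a random function is measurable, as a limit of difference quotients. -/
theorem aestronglyMeasurable_fderiv_of_ae {Ω : Type*} [MeasurableSpace Ω] {P : Measure Ω} {m : ℕ}
    {f : EuclideanSpace ℝ (Fin m) → Ω → ℝ} {f' : Ω → EuclideanSpace ℝ (Fin m) →L[ℝ] ℝ}
    {θ : EuclideanSpace ℝ (Fin m)} (hf : ∀ᶠ ϑ in 𝓝 θ, AEStronglyMeasurable (f ϑ) P)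
    (hd : ∀ᵐ ω ∂P, HasFDerivAt (fun ϑ => f ϑ ω) (f' ω) θ) : AEStronglyMeasurable f' P := by
  have hcoord : ∀ v, AEStronglyMeasurable (fun ω => f' ω v) P := by
    intro v
    have htend : Filter.Tendsto (fun n : ℕ => θ + (1 / ((n : ℝ) + 1)) • v) Filter.atTop (𝓝 θ) := by
      have := ((tendsto_one_div_add_atTop_nhds_zero_nat (𝕜 := ℝ)).smul_const v).const_add θ
      simpa using this
    obtain ⟨N, hN⟩ := Filter.eventually_atTop.1 (htend.eventually hf)
    refine aestronglyMeasurable_of_tendsto_ae Filter.atTop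
      (f := fun n ω => (((n + N : ℕ) : ℝ) + 1) •
        (f (θ + (1 / (((n + N : ℕ) : ℝ) + 1)) • v) ω - f θ ω)) ?_ ?_
    · intro n
      have h1 : AEStronglyMeasurable
          (fun ω => f (θ + (1 / (((n + N : ℕ) : ℝ) + 1)) • v) ω - f θ ω) P :=
        (hN (n + N) (by omega)).sub hf.self_of_nhds
      exact h1.const_smul (((n + N : ℕ) : ℝ) + 1)
    · filter_upwards [hd] with ω hω
      have h1 := hω.lim_real v
      have h2 : Filter.Tendsto (fun n : ℕ => (((n + N : ℕ) : ℝ) + 1)) Filter.atTop Filter.atTop :=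
        Filter.tendsto_atTop_add_const_right _ _
          (tendsto_natCast_atTop_atTop.comp (Filter.tendsto_add_atTop_nat N))
      have := h1.comp h2
      simpa [Function.comp_def] using this
  have hsum : f' = fun ω => ∑ i, f' ω (EuclideanSpace.single i 1) •
      (EuclideanSpace.proj i : EuclideanSpace ℝ (Fin m) →L[ℝ] ℝ) := by
    funext ω
    refine ContinuousLinearMap.ext fun v => ?_
    conv_lhs => rw [← (EuclideanSpace.basisFun (Fin m) ℝ).sum_repr v]
    simp [mul_comm]
  rw [hsum]
  have : (fun ω => ∑ i, f' ω (EuclideanSpace.single i 1) •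
      (EuclideanSpace.proj i : EuclideanSpace ℝ (Fin m) →L[ℝ] ℝ)) =
      ∑ i, fun ω => f' ω (EuclideanSpace.single i 1) •
      (EuclideanSpace.proj i : EuclideanSpace ℝ (Fin m) →L[ℝ] ℝ) := by
    funext ω; simp
  rw [this]
  exact Finset.aestronglyMeasurable_sum _ fun i _ => (hcoord _).smul_const _

/-! ### Combinatorics of the batches -/

/-- The label sequences in which every class recurs forever; on these the batches are well defined,
and they form an event of probability one. -/
def RecurrentLabels (a : ℕ → Fin 2) : Prop := ∀ c n, ∃ i, n ≤ i ∧ a i = c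

/-- The number of samples of class `c` among the indices in `[s, t)`. -/
def classCount (a : ℕ → Fin 2) (s t : ℕ) (c : Fin 2) : ℕ :=
  ((Finset.Ico s t).filter (fun i => a i = c)).card

theorem classCount_mono {a : ℕ → Fin 2} {s t t' : ℕ} (h : t ≤ t') (c : Fin 2) :
    classCount a s t c ≤ classCount a s t' c :=
  Finset.card_le_card (Finset.filter_subset_filter _ (Finset.Ico_subset_Ico le_rfl h))

theorem classCount_add {a : ℕ → Fin 2} {s t : ℕ} :
    classCount a s t 0 + classCount a s t 1 = t - s := by
  have h := Finset.card_filter_add_card_filter_not (s := Finset.Ico s t) (fun i => a i = 0)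
  have h2 : (Finset.Ico s t).filter (fun i => ¬ a i = 0) =
      (Finset.Ico s t).filter (fun i => a i = 1) := by
    refine Finset.filter_congr fun i _ => ?_
    have : ∀ x : Fin 2, ¬ x = 0 ↔ x = 1 := by decide
    exact this _
  rw [h2] at h
  simpa [classCount] using h

theorem classCount_succ {a : ℕ → Fin 2} {s t : ℕ} (h : s ≤ t) (c : Fin 2) :
    classCount a s (t + 1) c = classCount a s t c + if a t = c then 1 else 0 := by
  unfold classCount
  rw [← Finset.insert_Ico_right_eq_Ico_add_one h, Finset.filter_insert]
  split_ifs with h1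
  · rw [Finset.card_insert_of_notMem (by simp)]
  · simp

theorem classCount_congr {a a' : ℕ → Fin 2} {s t : ℕ} (h : ∀ i, s ≤ i → i < t → a i = a' i)
    (c : Fin 2) : classCount a s t c = classCount a' s t c := by
  unfold classCount
  congr 1
  refine Finset.filter_congr fun i hi => ?_
  rw [Finset.mem_Ico] at hi
  rw [h i hi.1 hi.2]

theorem classCount_comp_swap (a : ℕ → Fin 2) {s t i j : ℕ} (hi : i ∈ Finset.Ico s t)
    (hj : j ∈ Finset.Ico s t) (c : Fin 2) :
    classCount (a ∘ Equiv.swap i j) s t c = classCount a s t c := by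
  unfold classCount
  have hmem : ∀ k, k ∈ Finset.Ico s t → Equiv.swap i j k ∈ Finset.Ico s t := by
    intro k hk
    by_cases h1 : k = i
    · subst h1; simpa using hj
    by_cases h2 : k = j
    · subst h2; simpa using hi
    · rwa [Equiv.swap_apply_of_ne_of_ne h1 h2]
  refine Finset.card_bij' (fun k _ => Equiv.swap i j k) (fun k _ => Equiv.swap i j k) ?_ ?_
    (by simp) (by simp)
  · intro k hk
    rw [Finset.mem_filter] at hk ⊢
    exact ⟨hmem k hk.1, hk.2⟩
  · intro k hk
    rw [Finset.mem_filter] at hk ⊢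
    exact ⟨hmem k hk.1, by simpa using hk.2⟩

theorem RecurrentLabels.exists_classCount {a : ℕ → Fin 2} (ha : RecurrentLabels a) (s n : ℕ)
    (c : Fin 2) : ∃ t, n ≤ classCount a s t c := by
  induction n with
  | zero => exact ⟨0, Nat.zero_le _⟩
  | succ n ih =>
    obtain ⟨t, ht⟩ := ih
    obtain ⟨i, hi, hic⟩ := ha c (max s t)
    refine ⟨i + 1, ?_⟩
    rw [classCount_succ ((le_max_left _ _).trans hi), if_pos hic]
    have := classCount_mono (a := a) (s := s) ((le_max_right s t).trans hi) c
    omega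

theorem RecurrentLabels.congr {a a' : ℕ → Fin 2} (ha : RecurrentLabels a) {N : ℕ}
    (h : ∀ i, N ≤ i → a i = a' i) : RecurrentLabels a' := by
  intro c n
  obtain ⟨i, hi, hic⟩ := ha c (max n N)
  exact ⟨i, (le_max_left _ _).trans hi, by rw [← h i ((le_max_right _ _).trans hi), hic]⟩

/-- A batch that starts at `s` may end before index `t`. -/
def BatchComplete (Nbar : ℕ) (a : ℕ → Fin 2) (s t : ℕ) : Prop :=
  s + Nbar ≤ t ∧ ∀ c, 2 ≤ classCount a s t c

theorem BatchComplete.mono {Nbar : ℕ} {a : ℕ → Fin 2} {s t t' : ℕ} (h : BatchComplete Nbar a s t)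
    (htt : t ≤ t') : BatchComplete Nbar a s t' :=
  ⟨h.1.trans htt, fun c => (h.2 c).trans (classCount_mono htt c)⟩

theorem BatchComplete.congr {Nbar : ℕ} {a a' : ℕ → Fin 2} {s t : ℕ} (h : BatchComplete Nbar a s t)
    (ha : ∀ i, s ≤ i → i < t → a i = a' i) : BatchComplete Nbar a' s t :=
  ⟨h.1, fun c => (classCount_congr ha c) ▸ h.2 c⟩

theorem RecurrentLabels.exists_batchComplete {a : ℕ → Fin 2} (ha : RecurrentLabels a)
    (Nbar s : ℕ) : ∃ t, BatchComplete Nbar a s t := by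
  obtain ⟨t0, h0⟩ := ha.exists_classCount s 2 0
  obtain ⟨t1, h1⟩ := ha.exists_classCount s 2 1
  refine ⟨max (s + Nbar) (max t0 t1), le_max_left _ _, fun c => ?_⟩
  fin_cases c
  · exact h0.trans (classCount_mono ((le_max_left _ _).trans (le_max_right _ _)) _)
  · exact h1.trans (classCount_mono ((le_max_right _ _).trans (le_max_right _ _)) _)

section

variable {Nbar : ℕ} {a a' : ℕ → Fin 2} (b : ℕ)

theorem RecurrentLabels.batchComplete (ha : RecurrentLabels a) :
    BatchComplete Nbar a (batchStart Nbar a b) (batchStart Nbar a (b + 1)) :=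
  Nat.sInf_mem (s := {t | BatchComplete Nbar a (batchStart Nbar a b) t})
    (ha.exists_batchComplete Nbar _)

theorem batchStart_succ_le {t : ℕ} (ht : BatchComplete Nbar a (batchStart Nbar a b) t) :
    batchStart Nbar a (b + 1) ≤ t :=
  Nat.sInf_le (s := {t | BatchComplete Nbar a (batchStart Nbar a b) t}) ht

theorem RecurrentLabels.batchStart_le (ha : RecurrentLabels a) :
    batchStart Nbar a b ≤ batchStart Nbar a (b + 1) :=
  (Nat.le_add_right _ _).trans (ha.batchComplete b).1

/-- The batch starts are stopping times. -/
theorem RecurrentLabels.batchStart_congr (ha : RecurrentLabels a) (ha' : RecurrentLabels a')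
    (h : ∀ i < batchStart Nbar a b, a i = a' i) :
    batchStart Nbar a' b = batchStart Nbar a b := by
  induction b with
  | zero => rfl
  | succ b ih =>
    have hs := ih fun i hi => h i (hi.trans_le (ha.batchStart_le b))
    apply le_antisymm
    · refine batchStart_succ_le b ?_
      rw [hs]
      exact (ha.batchComplete b).congr fun i _ hi => h i hi
    · by_contra hlt
      push Not at hlt
      have h1 := (ha'.batchComplete (Nbar := Nbar) b).congr (a' := a)
        fun i _ hi => (h i (hi.trans hlt)).symm
      rw [hs] at h1
      exact absurd (batchStart_succ_le b h1) (not_le.2 hlt)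

/-- The end of the window over which the bias correction computes class frequencies: the end of the
batch if the batch has the target size, and one index earlier if the batch had to be extended until
its last sample completed the scarce class. -/
def windowEnd (Nbar : ℕ) (a : ℕ → Fin 2) (b : ℕ) : ℕ :=
  if batchStart Nbar a (b + 1) = batchStart Nbar a b + Nbar then batchStart Nbar a (b + 1)
  else batchStart Nbar a (b + 1) - 1

theorem RecurrentLabels.le_windowEnd (ha : RecurrentLabels a) :
    batchStart Nbar a b + Nbar ≤ windowEnd Nbar a b := by
  have := (ha.batchComplete (Nbar := Nbar) b).1
  unfold windowEnd
  split_ifs <;> omega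

/-- Given the start of the batch, the end of the window depends on the labels inside the window only
through their class counts. -/
theorem RecurrentLabels.windowEnd_congr (ha : RecurrentLabels a) (ha' : RecurrentLabels a')
    (hs : batchStart Nbar a' b = batchStart Nbar a b)
    (h : ∀ t, windowEnd Nbar a b ≤ t → ∀ c,
      classCount a' (batchStart Nbar a b) t c = classCount a (batchStart Nbar a b) t c) :
    windowEnd Nbar a' b = windowEnd Nbar a b := by
  suffices he : batchStart Nbar a' (b + 1) = batchStart Nbar a (b + 1) by
    unfold windowEnd; rw [he, hs]
  have hle : windowEnd Nbar a b ≤ batchStart Nbar a (b + 1) := by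
    unfold windowEnd; split_ifs <;> omega
  have hcomp := ha.batchComplete (Nbar := Nbar) b
  apply le_antisymm
  · refine batchStart_succ_le b ?_
    rw [hs]
    exact ⟨hcomp.1, fun c => by rw [h _ hle c]; exact hcomp.2 c⟩
  · have hcomp' := ha'.batchComplete (Nbar := Nbar) b
    rw [hs] at hcomp'
    by_cases heq : batchStart Nbar a (b + 1) = batchStart Nbar a b + Nbar
    · rw [heq]; exact hcomp'.1
    · by_contra hlt
      push Not at hlt
      have hw : windowEnd Nbar a b = batchStart Nbar a (b + 1) - 1 := by
        unfold windowEnd; rw [if_neg heq]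
      have h1 := hcomp'.mono (t' := windowEnd Nbar a b) (by omega)
      have h2 : BatchComplete Nbar a (batchStart Nbar a b) (windowEnd Nbar a b) :=
        ⟨h1.1, fun c => by rw [← h _ le_rfl c]; exact h1.2 c⟩
      have := batchStart_succ_le b h2
      omega

theorem RecurrentLabels.comp_swap (ha : RecurrentLabels a) (i j : ℕ) :
    RecurrentLabels (a ∘ Equiv.swap i j) :=
  ha.congr (N := max i j + 1) fun k hk => by
    have h1 : k ≠ i := by have := le_max_left i j; omega
    have h2 : k ≠ j := by have := le_max_right i j; omega
    simp [Equiv.swap_apply_of_ne_of_ne h1 h2]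

theorem RecurrentLabels.batchStart_comp_swap (ha : RecurrentLabels a) {i : ℕ}
    (hi : batchStart Nbar a b ≤ i) :
    batchStart Nbar (a ∘ Equiv.swap (batchStart Nbar a b) i) b = batchStart Nbar a b :=
  ha.batchStart_congr b (ha.comp_swap _ _) fun k hk => by
    simp [Equiv.swap_apply_of_ne_of_ne (show k ≠ batchStart Nbar a b by omega)
      (show k ≠ i by omega)]

theorem RecurrentLabels.windowEnd_comp_swap (ha : RecurrentLabels a) {i : ℕ}
    (hi : batchStart Nbar a b ≤ i) (hi' : i < windowEnd Nbar a b) :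
    windowEnd Nbar (a ∘ Equiv.swap (batchStart Nbar a b) i) b = windowEnd Nbar a b :=
  ha.windowEnd_congr b (ha.comp_swap _ _) (ha.batchStart_comp_swap b hi) fun t ht c =>
    classCount_comp_swap a (Finset.mem_Ico.2 ⟨le_rfl, by omega⟩)
      (Finset.mem_Ico.2 ⟨hi, by omega⟩) c

theorem card_batch : (batch Nbar a b).card = batchStart Nbar a (b + 1) - batchStart Nbar a b := by
  simp [batch]

theorem card_batchClass (c : Fin 2) : (batchClass Nbar a b c).card =
    classCount a (batchStart Nbar a b) (batchStart Nbar a (b + 1)) c := rfl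

theorem RecurrentLabels.two_le_card_batchClass (ha : RecurrentLabels a) (c : Fin 2) :
    2 ≤ (batchClass Nbar a b c).card :=
  (ha.batchComplete b).2 c

/-- The corrected weight of class `c` in a batch is its relative frequency in the window. -/
theorem RecurrentLabels.card_mul_biasCorrection (hNbar : 4 ≤ Nbar) (ha : RecurrentLabels a)
    (c : Fin 2) :
    ((batchClass Nbar a b c).card : ℝ) *
        biasCorrection Nbar (batch Nbar a b).card (batchClass Nbar a b c).card /
          (batch Nbar a b).card =
      classCount a (batchStart Nbar a b) (windowEnd Nbar a b) c /
        ((windowEnd Nbar a b - batchStart Nbar a b : ℕ) : ℝ) := by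
  rw [card_batch, card_batchClass]
  have hcomp := ha.batchComplete (Nbar := Nbar) b
  set s := batchStart Nbar a b with hs
  set e := batchStart Nbar a (b + 1) with he
  by_cases heq : e = s + Nbar
  · have hw : windowEnd Nbar a b = e := by
      unfold windowEnd; rw [← hs, ← he, if_pos heq]
    have hN : e - s = Nbar := by omega
    rw [hw, hN]
    simp [biasCorrection]
  · have hw : windowEnd Nbar a b = e - 1 := by
      unfold windowEnd; rw [← hs, ← he, if_neg heq]
    have hlt : s + Nbar < e := lt_of_le_of_ne hcomp.1 (Ne.symm heq)
    obtain ⟨u, hu⟩ : ∃ u, e = u + 1 := ⟨e - 1, by omega⟩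
    have hwu : windowEnd Nbar a b = u := by omega
    have hnot : ¬ BatchComplete Nbar a s u := fun h => by
      have : e ≤ u := batchStart_succ_le b h
      omega
    have hsu : s ≤ u := by omega
    -- the class completed by the last sample has one sample in the window
    have hone : ∃ c', classCount a s u c' < 2 := by
      by_contra hcon
      push Not at hcon
      exact hnot ⟨by omega, hcon⟩
    have hsum := classCount_add (a := a) (s := s) (t := u)
    have hsum' := classCount_add (a := a) (s := s) (t := e)
    have hc := classCount_succ (a := a) hsu
    rw [hwu]
    have key : (classCount a s e c = 2 ∧ classCount a s u c = 1) ∨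
        (classCount a s e c + 2 = e - s ∧ classCount a s u c + 1 = u - s) := by
      obtain ⟨c', hc'⟩ := hone
      have h0 := hc 0
      have h1 := hc 1
      have e0 := hcomp.2 0
      have e1 := hcomp.2 1
      rw [hu] at e0 e1 hsum' ⊢
      rcases Fin.exists_fin_two.1 ⟨a u, rfl⟩ with hau | hau <;>
      rw [hau] at h0 h1 <;>
      simp only [reduceIte, one_ne_zero, zero_ne_one] at h0 h1 <;>
      fin_cases c <;> fin_cases c' <;>
      simp only [Fin.zero_eta, Fin.mk_one] at hc' ⊢ <;> omega
    have hN : ((e - s : ℕ) : ℝ) = (u - s : ℕ) + 1 := by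
      rw [hu, Nat.succ_sub hsu]; push_cast; ring
    have hpos : (0 : ℝ) < (u - s : ℕ) := by
      have : 0 < u - s := by omega
      exact_mod_cast this
    have hne : e - s ≠ Nbar := by omega
    have hltN : Nbar < e - s := by omega
    rcases key with ⟨k1, k2⟩ | ⟨k1, k2⟩
    · have hne2 : ¬ (2 + 2 = e - s) := by omega
      rw [k1, k2]
      simp only [biasCorrection, hne, hltN, hne2, if_false, and_false, and_self, if_true]
      rw [hN, add_sub_cancel_right]
      push_cast
      field_simp
      norm_num
    · have hne2 : ¬ (classCount a s e c = 2) := by omega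
      have k1' : (classCount a s e c : ℝ) = (u - s : ℕ) - 1 := by
        have : classCount a s e c + 1 = u - s := by omega
        rw [← this]; push_cast; ring
      have k2' : (classCount a s u c : ℝ) = (u - s : ℕ) - 1 := by
        rw [← k2]; push_cast; ring
      simp only [biasCorrection, hne, hltN, hne2, k1, if_false, and_false, and_self, if_true]
      rw [hN, k1', k2', add_sub_cancel_right]
      field_simp
      ring

theorem biasCorrection_nonneg {Nbar : ℕ} (N n : ℕ) : 0 ≤ biasCorrection Nbar N n := by
  unfold biasCorrection
  rcases Nat.eq_zero_or_pos N with rfl | hN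
  · simp; split_ifs <;> norm_num
  · have : (1 : ℝ) ≤ N := by exact_mod_cast hN
    have h1 : (0 : ℝ) ≤ N - 1 := by linarith
    positivity

end

/-! ### The law of the label sequence -/

/-- A function pieced together along the values of a measurable map with countable range is
measurable. -/
theorem measurable_comp_countable {Ω ι β : Type*} [MeasurableSpace Ω] [MeasurableSpace β]
    [Countable ι] [MeasurableSpace ι] [MeasurableSingletonClass ι] {T : Ω → ι}
    (hT : Measurable T) {G : ι → Ω → β} (hG : ∀ i, Measurable (G i)) :
    Measurable fun ω => G (T ω) ω :=
  (measurable_from_prod_countable_right (f := fun p : ι × Ω => G p.1 p.2) hG).comp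
    (hT.prodMk measurable_id)

theorem measurableSet_label_eq (i : ℕ) (c : Fin 2) : MeasurableSet {a : ℕ → Fin 2 | a i = c} :=
  measurableSet_eq_fun (measurable_pi_apply i) measurable_const

theorem measurable_classCount (s t : ℕ) (c : Fin 2) :
    Measurable fun a : ℕ → Fin 2 => classCount a s t c := by
  unfold classCount
  simp only [Finset.card_filter]
  exact Finset.measurable_sum _ fun i _ =>
    Measurable.ite (measurableSet_label_eq i c) measurable_const measurable_const

theorem measurableSet_batchComplete (Nbar s t : ℕ) :
    MeasurableSet {a : ℕ → Fin 2 | BatchComplete Nbar a s t} := by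
  refine (MeasurableSet.const _).inter (?_ : MeasurableSet {a | ∀ c, 2 ≤ classCount a s t c})
  rw [Set.ofPred_forall]
  exact MeasurableSet.iInter fun c => measurableSet_le measurable_const (measurable_classCount s t c)

theorem measurable_batchStart (Nbar b : ℕ) :
    Measurable fun a : ℕ → Fin 2 => batchStart Nbar a b := by
  classical
  induction b with
  | zero => exact measurable_const
  | succ b ih =>
    refine measurable_comp_countable (G := fun s a => sInf {t | BatchComplete Nbar a s t}) ih ?_
    intro s
    refine measurable_to_countable' fun n => ?_
    have : (fun a => sInf {t | BatchComplete Nbar a s t}) ⁻¹' {n} =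
        ({a | BatchComplete Nbar a s n} ∩ ⋂ k : ℕ, ⋂ _ : k < n, {a | BatchComplete Nbar a s k}ᶜ) ∪
        ({_a : ℕ → Fin 2 | n = 0} ∩ ⋂ k : ℕ, {a | BatchComplete Nbar a s k}ᶜ) := by
      ext a
      simp only [Set.mem_preimage, Set.mem_singleton_iff, Set.mem_union, Set.mem_inter_iff,
        Set.mem_ofPred_eq, Set.mem_iInter, Set.mem_compl_iff]
      constructor
      · intro h
        rcases Set.eq_empty_or_nonempty {t | BatchComplete Nbar a s t} with he | hne
        · rw [he, Nat.sInf_empty] at h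
          exact Or.inr ⟨h.symm, fun k hk => (Set.eq_empty_iff_forall_notMem.1 he) k hk⟩
        · left
          rw [← h]
          exact ⟨Nat.sInf_mem hne, fun k hk hk' => Nat.notMem_of_lt_sInf hk hk'⟩
      · rintro (⟨h1, h2⟩ | ⟨rfl, h2⟩)
        · refine le_antisymm (Nat.sInf_le h1) ?_
          by_contra hlt
          exact h2 _ (not_le.1 hlt) (Nat.sInf_mem (s := {t | BatchComplete Nbar a s t}) ⟨n, h1⟩)
        · rw [show {t | BatchComplete Nbar a s t} = ∅ from Set.eq_empty_iff_forall_notMem.2 h2,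
            Nat.sInf_empty]
    rw [this]
    have hm := fun t => measurableSet_batchComplete Nbar s t
    exact ((hm n).inter (MeasurableSet.iInter fun k => MeasurableSet.iInter fun _ =>
      (hm k).compl)).union ((MeasurableSet.const _).inter (MeasurableSet.iInter fun k =>
      (hm k).compl))

theorem measurable_windowEnd (Nbar b : ℕ) :
    Measurable fun a : ℕ → Fin 2 => windowEnd Nbar a b := by
  have h : Measurable fun a : ℕ → Fin 2 => (batchStart Nbar a b, batchStart Nbar a (b + 1)) :=
    (measurable_batchStart Nbar b).prodMk (measurable_batchStart Nbar (b + 1))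
  exact (measurable_of_countable fun p : ℕ × ℕ =>
    if p.2 = p.1 + Nbar then p.2 else p.2 - 1).comp h

theorem measurableSet_recurrentLabels : MeasurableSet {a : ℕ → Fin 2 | RecurrentLabels a} := by
  have : {a : ℕ → Fin 2 | RecurrentLabels a} =
      ⋂ c : Fin 2, ⋂ n : ℕ, ⋃ i : ℕ, {a | n ≤ i ∧ a i = c} := by
    ext a; simp [RecurrentLabels]
  rw [this]
  refine MeasurableSet.iInter fun c => MeasurableSet.iInter fun n => MeasurableSet.iUnion fun i => ?_
  exact (MeasurableSet.const _).inter (measurableSet_label_eq i c)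

section

variable {Ω : Type*} [MeasurableSpace Ω] {P : Measure Ω}

/-- A functional of the labels and a functional of the samples with indices in `J` factorize once
the labels of these samples are pinned down: changing the labels at `J` to their known values makes
the first functional independent of the second. -/
theorem lintegral_labels_mul {S : Type*} [MeasurableSpace S] {Z : ℕ → Ω → S}
    (hZ : ∀ i, Measurable (Z i)) (hindep : iIndepFun Z P) {g : S → Fin 2} (hg : Measurable g)
    (J : Finset ℕ) (v : ℕ → Fin 2) {W : (ℕ → Fin 2) → ENNReal} (hW : Measurable W)
    {F : Ω → ENNReal}
    (hF : Measurable[⨆ i ∈ (J : Set ℕ), MeasurableSpace.comap (Z i) inferInstance] F)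
    (hFv : ∀ ω, F ω ≠ 0 → ∀ i ∈ J, g (Z i ω) = v i) :
    ∫⁻ ω, W (fun i => g (Z i ω)) * F ω ∂P =
      (∫⁻ ω, W (fun i => if i ∈ J then v i else g (Z i ω)) ∂P) * ∫⁻ ω, F ω ∂P := by
  have h1 : ∀ ω, W (fun i => g (Z i ω)) * F ω =
      W (fun i => if i ∈ J then v i else g (Z i ω)) * F ω := by
    intro ω
    by_cases h : F ω = 0
    · simp [h]
    · congr 2
      funext i
      split_ifs with hi
      · exact hFv ω h i hi
      · rfl
  simp_rw [h1]
  have hle : ∀ i, MeasurableSpace.comap (Z i) inferInstance ≤ (inferInstance : MeasurableSpace Ω) :=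
    fun i => (hZ i).comap_le
  refine lintegral_mul_eq_lintegral_mul_lintegral_of_independent_measurableSpace
    (Mf := ⨆ i ∈ ((J : Set ℕ)ᶜ), MeasurableSpace.comap (Z i) inferInstance)
    (Mg := ⨆ i ∈ (J : Set ℕ), MeasurableSpace.comap (Z i) inferInstance)
    (iSup₂_le fun i _ => hle i) (iSup₂_le fun i _ => hle i)
    (indep_iSup_of_disjoint hle hindep.iIndep disjoint_compl_left) ?_ hF
  refine hW.comp ?_
  refine (@measurable_pi_iff _ _ _ (_) _ _).2 fun i => ?_
  by_cases hi : i ∈ J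
  · simp only [hi, if_true]
    exact measurable_const
  · simp only [hi, if_false]
    have h2 : Measurable[MeasurableSpace.comap (Z i) inferInstance] (Z i) := comap_measurable _
    have h3 : MeasurableSpace.comap (Z i) inferInstance ≤
        ⨆ i ∈ ((J : Set ℕ)ᶜ), MeasurableSpace.comap (Z i) inferInstance :=
      le_iSup₂_of_le i (by simpa using hi) le_rfl
    exact (hg.comp h2).mono h3 le_rfl

variable {A : ℕ → Ω → Fin 2} (hA : ∀ i, Measurable (A i)) (hindep : iIndepFun A P)
  {p : Fin 2 → ENNReal} (hp : ∀ i c, P (A i ⁻¹' {c}) = p c)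

include hA hindep hp

theorem ae_recurrentLabels [IsProbabilityMeasure P] (hpos : ∀ c, p c ≠ 0) :
    ∀ᵐ ω ∂P, RecurrentLabels fun i => A i ω := by
  have h : ∀ c, ∀ᵐ ω ∂P, ω ∈ Filter.limsup (fun i => A i ⁻¹' {c}) Filter.atTop := by
    intro c
    have hm : ∀ i, MeasurableSet (A i ⁻¹' {c}) := fun i => hA i (measurableSet_singleton c)
    refine (mem_ae_iff_prob_eq_one (MeasurableSet.measurableSet_limsup hm)).2 ?_
    refine measure_limsup_eq_one hm ?_ ?_
    · rw [iIndepSet_iff_meas_biInter hm]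
      intro J
      exact hindep.measure_inter_preimage_eq_mul J (sets := fun _ => {c})
        fun _ _ => measurableSet_singleton c
    · simp only [hp]
      exact ENNReal.tsum_const_eq_top_of_ne_zero (hpos c)
  filter_upwards [ae_all_iff.2 h] with ω hω c n
  have := hω c
  rw [Filter.mem_limsup_iff_frequently_mem, Filter.frequently_atTop] at this
  obtain ⟨i, hi, hic⟩ := this n
  exact ⟨i, hi, hic⟩

/-- The law of the label sequence is invariant under permutations of the samples. -/
theorem lintegral_labels_comp_swap (σ : Equiv.Perm ℕ) {W : (ℕ → Fin 2) → ENNReal}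
    (hW : Measurable W) :
    ∫⁻ ω, W ((fun i => A i ω) ∘ σ) ∂P = ∫⁻ ω, W (fun i => A i ω) ∂P := by
  have hmap : ∀ i j, P.map (A i) = P.map (A j) := fun i j => by
    refine Measure.ext_of_singleton fun c => ?_
    rw [Measure.map_apply (hA i) (measurableSet_singleton c),
      Measure.map_apply (hA j) (measurableSet_singleton c), hp, hp]
  have h1 := hindep.map_fun_eq_infinitePi_map hA
  have h2 := (hindep.precomp σ.injective).map_fun_eq_infinitePi_map (fun i => hA (σ i))
  have h3 : P.map (fun ω i => A (σ i) ω) = P.map (fun ω i => A i ω) := by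
    rw [h1]
    refine h2.trans ?_
    congr 1
    funext i
    exact hmap _ _
  have hm1 : Measurable fun ω i => A (σ i) ω := measurable_pi_iff.2 fun i => hA _
  have hm2 : Measurable fun ω i => A i ω := measurable_pi_iff.2 hA
  calc ∫⁻ ω, W ((fun i => A i ω) ∘ σ) ∂P = ∫⁻ a, W a ∂(P.map fun ω i => A (σ i) ω) :=
        (lintegral_map hW hm1).symm
    _ = ∫⁻ a, W a ∂(P.map fun ω i => A i ω) := by rw [h3]
    _ = ∫⁻ ω, W (fun i => A i ω) ∂P := lintegral_map hW hm2

/-- The expected relative frequency of a class in the window of a batch is the probability of the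
class. The start and the end of the window are invariant under transpositions inside the window, so
that by exchangeability every sample in the window may be replaced by the first one, whose label is
independent of the start. -/
theorem lintegral_windowFrequency [IsProbabilityMeasure P] (hpos : ∀ c, p c ≠ 0) {Nbar : ℕ} (hNbar : 0 < Nbar) (b : ℕ)
    (c : Fin 2) :
    ∫⁻ ω, ENNReal.ofReal (classCount (fun i => A i ω) (batchStart Nbar (fun i => A i ω) b)
      (windowEnd Nbar (fun i => A i ω) b) c /
      ((windowEnd Nbar (fun i => A i ω) b - batchStart Nbar (fun i => A i ω) b : ℕ) : ℝ)) ∂P =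
      p c := by
  classical
  set α : Ω → ℕ → Fin 2 := fun ω i => A i ω
  have hα : Measurable α := measurable_pi_iff.2 hA
  set D : ℕ × ℕ → Set (ℕ → Fin 2) := fun q =>
    {a | RecurrentLabels a ∧ batchStart Nbar a b = q.1 ∧ windowEnd Nbar a b = q.2}
  have hD : ∀ q, MeasurableSet (D q) := fun q => measurableSet_recurrentLabels.inter
    ((measurable_batchStart Nbar b (measurableSet_singleton q.1)).inter
      (measurable_windowEnd Nbar b (measurableSet_singleton q.2)))
  set E : ℕ × ℕ → (ℕ → Fin 2) → ENNReal := fun q => (D q).indicator 1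
  have hE : ∀ q, Measurable (E q) := fun q => measurable_one.indicator (hD q)
  set χ : ℕ → (ℕ → Fin 2) → ENNReal := fun i a => if a i = c then 1 else 0
  have hχ : ∀ i, Measurable (χ i) := fun i =>
    Measurable.ite (measurableSet_label_eq i c) measurable_const measurable_const
  have hEχ : ∀ q i, Measurable fun ω => E q (α ω) * χ i (α ω) := fun q i =>
    ((hE q).comp hα).mul ((hχ i).comp hα)
  have hrec := ae_recurrentLabels hA hindep hp hpos
  -- decomposition according to the position of the window
  have step1 : ∀ a, RecurrentLabels a →
      ENNReal.ofReal (classCount a (batchStart Nbar a b) (windowEnd Nbar a b) c /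
        ((windowEnd Nbar a b - batchStart Nbar a b : ℕ) : ℝ)) =
      ∑' q : ℕ × ℕ, (∑ i ∈ Finset.Ico q.1 q.2, E q a * χ i a) / ((q.2 - q.1 : ℕ) : ENNReal) := by
    intro a ha
    rw [tsum_eq_single (batchStart Nbar a b, windowEnd Nbar a b)]
    · have hmem : a ∈ D (batchStart Nbar a b, windowEnd Nbar a b) := ⟨ha, rfl, rfl⟩
      have hlt : 0 < windowEnd Nbar a b - batchStart Nbar a b := by
        have := ha.le_windowEnd (Nbar := Nbar) b
        omega
      rw [ENNReal.ofReal_div_of_pos (by exact_mod_cast hlt), ENNReal.ofReal_natCast,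
        ENNReal.ofReal_natCast]
      congr 1
      simp only [E, Set.indicator_of_mem hmem, Pi.one_apply, one_mul, χ, classCount,
        Finset.card_filter]
      push_cast
      rfl
    · intro q hq
      have hmem : a ∉ D q := fun h => hq (Prod.ext h.2.1.symm h.2.2.symm)
      simp [E, Set.indicator_of_notMem hmem]
  -- exchangeability inside the window
  have step2 : ∀ q : ℕ × ℕ, ∀ i ∈ Finset.Ico q.1 q.2,
      ∫⁻ ω, E q (α ω) * χ i (α ω) ∂P = ∫⁻ ω, E q (α ω) * χ q.1 (α ω) ∂P := by
    intro q i hi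
    rw [Finset.mem_Ico] at hi
    have hsw := lintegral_labels_comp_swap hA hindep hp (Equiv.swap q.1 i)
      (W := fun a => E q a * χ i a) ((hE q).mul (hχ i))
    rw [← hsw]
    refine lintegral_congr fun ω => ?_
    have hmaps : ∀ a, a ∈ D q → a ∘ Equiv.swap q.1 i ∈ D q := by
      rintro a ⟨ha, h1, h2⟩
      refine ⟨ha.comp_swap _ _, ?_, ?_⟩
      · have := ha.batchStart_comp_swap b (Nbar := Nbar) (i := i) (by omega)
        rwa [h1] at this
      · have := ha.windowEnd_comp_swap b (Nbar := Nbar) (i := i) (by omega) (by omega)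
        rwa [h1, h2] at this
    have hiff : α ω ∘ Equiv.swap q.1 i ∈ D q ↔ α ω ∈ D q := by
      refine ⟨fun h => ?_, hmaps _⟩
      have := hmaps _ h
      convert this using 1
      funext k
      simp
    have hEq : E q (α ω ∘ Equiv.swap q.1 i) = E q (α ω) := by
      by_cases h : α ω ∈ D q
      · simp [E, Set.indicator_of_mem h, Set.indicator_of_mem (hiff.2 h)]
      · simp [E, Set.indicator_of_notMem h, Set.indicator_of_notMem (mt hiff.1 h)]
    have hχq : χ i (α ω ∘ Equiv.swap q.1 i) = χ q.1 (α ω) := by simp [χ]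
    exact congr_arg₂ (· * ·) hEq hχq
  have step3 : ∀ q : ℕ × ℕ,
      ∫⁻ ω, (∑ i ∈ Finset.Ico q.1 q.2, E q (α ω) * χ i (α ω)) / ((q.2 - q.1 : ℕ) : ENNReal) ∂P =
      ∫⁻ ω, E q (α ω) * χ q.1 (α ω) ∂P := by
    intro q
    by_cases hq : q.1 < q.2
    · have hne : ((q.2 - q.1 : ℕ) : ENNReal) ≠ 0 := by
        rw [Nat.cast_ne_zero]
        omega
      simp only [div_eq_mul_inv]
      rw [lintegral_mul_const _ (Finset.measurable_sum _ fun i _ => hEχ q i),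
        lintegral_finsetSum _ (fun i _ => hEχ q i),
        Finset.sum_congr rfl (step2 q), Finset.sum_const, Nat.card_Ico, nsmul_eq_mul,
        mul_comm ((q.2 - q.1 : ℕ) : ENNReal), mul_assoc,
        ENNReal.mul_inv_cancel hne (ENNReal.natCast_ne_top _), mul_one]
    · have hempty : ∀ ω, E q (α ω) = 0 := fun ω => by
        refine Set.indicator_of_notMem (fun h => hq ?_) _
        have := h.1.le_windowEnd (Nbar := Nbar) b
        have h1 := h.2.1
        have h2 := h.2.2
        omega
      simp [hempty]
  -- independence of the first label from the start of the window
  set D' : ℕ → Set (ℕ → Fin 2) := fun s => {a | RecurrentLabels a ∧ batchStart Nbar a b = s}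
  have hD' : ∀ s, MeasurableSet (D' s) := fun s => measurableSet_recurrentLabels.inter
    (measurable_batchStart Nbar b (measurableSet_singleton s))
  set E' : ℕ → (ℕ → Fin 2) → ENNReal := fun s => (D' s).indicator 1
  have hE' : ∀ s, Measurable (E' s) := fun s => measurable_one.indicator (hD' s)
  have step4 : ∀ s, ∫⁻ ω, E' s (α ω) * χ s (α ω) ∂P = (∫⁻ ω, E' s (α ω) ∂P) * p c := by
    intro s
    have h1 := lintegral_labels_mul hA hindep (g := id) measurable_id {s} (fun _ => c) (hE' s)
      (F := fun ω => χ s (α ω)) ?_ ?_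
    · have h2 : ∫⁻ ω, χ s (α ω) ∂P = p c := by
        have : (fun ω => χ s (α ω)) = (A s ⁻¹' {c}).indicator 1 := by
          funext ω
          simp [χ, α, Set.indicator]
        rw [this, lintegral_indicator_one (hA s (measurableSet_singleton c)), hp]
      rw [h2] at h1
      refine h1.trans ?_
      congr 1
      refine lintegral_congr fun ω => ?_
      set a' : ℕ → Fin 2 := fun i => if i ∈ ({s} : Finset ℕ) then c else id (A i ω)
      have h3 : ∀ i, i ≠ s → a' i = α ω i := fun i hi => by simp [a', hi, α]
      have hiff : a' ∈ D' s ↔ α ω ∈ D' s := by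
        constructor
        · rintro ⟨hr, hs⟩
          have hr' : RecurrentLabels (α ω) :=
            hr.congr (N := s + 1) fun i hi => h3 i (by omega)
          refine ⟨hr', ?_⟩
          rw [hr.batchStart_congr b hr' fun i hi => h3 i (by omega), hs]
        · rintro ⟨hr, hs⟩
          have hr' : RecurrentLabels a' :=
            hr.congr (N := s + 1) fun i hi => (h3 i (by omega)).symm
          refine ⟨hr', ?_⟩
          rw [hr.batchStart_congr b hr' fun i hi => (h3 i (by omega)).symm, hs]
      change E' s a' = E' s (α ω)
      by_cases h : α ω ∈ D' s
      · simp [E', Set.indicator_of_mem h, Set.indicator_of_mem (hiff.2 h)]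
      · simp [E', Set.indicator_of_notMem h, Set.indicator_of_notMem (mt hiff.1 h)]
    · have h2 : Measurable[MeasurableSpace.comap (A s) inferInstance] (A s) := comap_measurable _
      have h3 : MeasurableSpace.comap (A s) inferInstance ≤
          ⨆ i ∈ (({s} : Finset ℕ) : Set ℕ), MeasurableSpace.comap (A i) inferInstance :=
        le_iSup₂_of_le s (by simp) le_rfl
      exact ((measurable_of_countable fun x : Fin 2 => if x = c then (1 : ENNReal) else 0).comp
        h2).mono h3 le_rfl
    · intro ω hω i hi
      rw [Finset.mem_singleton] at hi
      subst hi
      by_contra hne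
      exact hω (if_neg hne)
  have step5 : ∀ s a, ∑' u, E (s, u) a = E' s a := by
    intro s a
    by_cases h : a ∈ D' s
    · rw [tsum_eq_single (windowEnd Nbar a b)]
      · have : a ∈ D (s, windowEnd Nbar a b) := ⟨h.1, h.2, rfl⟩
        simp [E, E', Set.indicator_of_mem h, Set.indicator_of_mem this]
      · intro u hu
        have : a ∉ D (s, u) := fun h' => hu h'.2.2.symm
        simp [E, Set.indicator_of_notMem this]
    · have : ∀ u, a ∉ D (s, u) := fun u h' => h ⟨h'.1, h'.2.1⟩
      simp [E, E', Set.indicator_of_notMem h, Set.indicator_of_notMem (this _)]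
  have step6 : ∀ a, RecurrentLabels a → ∑' s, E' s a = 1 := by
    intro a ha
    rw [tsum_eq_single (batchStart Nbar a b)]
    · have : a ∈ D' (batchStart Nbar a b) := ⟨ha, rfl⟩
      simp [E', Set.indicator_of_mem this]
    · intro s hs
      have : a ∉ D' s := fun h' => hs h'.2.symm
      simp [E', Set.indicator_of_notMem this]
  calc ∫⁻ ω, ENNReal.ofReal (classCount (α ω) (batchStart Nbar (α ω) b) (windowEnd Nbar (α ω) b) c /
        ((windowEnd Nbar (α ω) b - batchStart Nbar (α ω) b : ℕ) : ℝ)) ∂P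
      = ∫⁻ ω, ∑' q : ℕ × ℕ, (∑ i ∈ Finset.Ico q.1 q.2, E q (α ω) * χ i (α ω)) /
          ((q.2 - q.1 : ℕ) : ENNReal) ∂P := lintegral_congr_ae (by
        filter_upwards [hrec] with ω hω using step1 _ hω)
    _ = ∑' q : ℕ × ℕ, ∫⁻ ω, E q (α ω) * χ q.1 (α ω) ∂P := by
        rw [lintegral_tsum]
        · exact tsum_congr step3
        · intro q
          exact ((Finset.measurable_sum _ fun i _ => hEχ q i).div_const _).aemeasurable
    _ = ∑' s, ∑' u, ∫⁻ ω, E (s, u) (α ω) * χ s (α ω) ∂P :=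
        ENNReal.tsum_prod (f := fun s u => ∫⁻ ω, E (s, u) (α ω) * χ s (α ω) ∂P)
    _ = ∑' s, ∫⁻ ω, E' s (α ω) * χ s (α ω) ∂P := by
        refine tsum_congr fun s => ?_
        rw [← lintegral_tsum fun u => (hEχ (s, u) s).aemeasurable]
        refine lintegral_congr fun ω => ?_
        rw [ENNReal.tsum_mul_right, step5]
    _ = (∫⁻ ω, ∑' s, E' s (α ω) ∂P) * p c := by
        have hE'α : ∀ s, Measurable fun ω => E' s (α ω) := fun s => (hE' s).comp hα
        rw [lintegral_tsum fun s => (hE'α s).aemeasurable, ← ENNReal.tsum_mul_right]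
        exact tsum_congr step4
    _ = p c := by
        have : ∫⁻ ω, ∑' s, E' s (α ω) ∂P = ∫⁻ _, 1 ∂P := lintegral_congr_ae (by
          filter_upwards [hrec] with ω hω using step6 _ hω)
        rw [this, lintegral_one, measure_univ, one_mul]

end

/-! ### Expectations of batch averages -/

/-- The bias-corrected average over the `b`-th batch of the values `v i`. -/
def correctedMean (Nbar : ℕ) (a : ℕ → Fin 2) (b : ℕ) (v : ℕ → ℝ) : ℝ :=
  1 / ((batch Nbar a b).card : ℝ) *
    ∑ c : Fin 2, ∑ i ∈ batchClass Nbar a b c,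
      biasCorrection Nbar (batch Nbar a b).card (batchClass Nbar a b c).card * v i

/-- The pairs of distinct indices in `[s, t)`, the first of class `c`, the second of class `c'`. -/
def labelPairs (a : ℕ → Fin 2) (s t : ℕ) (c c' : Fin 2) : Finset (ℕ × ℕ) :=
  ((Finset.Ico s t).filter (fun i => a i = c) ×ˢ (Finset.Ico s t).filter (fun i => a i = c')).filter
    fun q => q.1 ≠ q.2

/-- The pairs of distinct samples of the `b`-th batch, the first of class `c`, the second of class
`c'`. -/
def classPairs (Nbar : ℕ) (a : ℕ → Fin 2) (b : ℕ) (c c' : Fin 2) : Finset (ℕ × ℕ) :=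
  labelPairs a (batchStart Nbar a b) (batchStart Nbar a (b + 1)) c c'

theorem classPairs_eq_filter (Nbar : ℕ) (a : ℕ → Fin 2) (b : ℕ) (c c' : Fin 2) :
    classPairs Nbar a b c c' =
      (batchClass Nbar a b c ×ˢ batchClass Nbar a b c').filter fun q => q.1 ≠ q.2 := rfl

/-- The average of the values `v i j` over the pairs of distinct samples of classes `c` and `c'` in
the `b`-th batch. -/
def pairMean (Nbar : ℕ) (a : ℕ → Fin 2) (b : ℕ) (c c' : Fin 2) (v : ℕ → ℕ → ℝ) : ℝ :=
  ∑ q ∈ classPairs Nbar a b c c', ((classPairs Nbar a b c c').card : ℝ)⁻¹ * v q.1 q.2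

theorem sum_classPairs {Nbar : ℕ} {a : ℕ → Fin 2} {b : ℕ} {c c' : Fin 2} {M : Type*}
    [AddCommMonoid M] (f : ℕ → ℕ → M) :
    ∑ q ∈ classPairs Nbar a b c c', f q.1 q.2 =
      ∑ i ∈ batchClass Nbar a b c, ∑ j ∈ (batchClass Nbar a b c').erase i, f i j := by
  rw [classPairs_eq_filter, Finset.sum_filter, Finset.sum_product]
  refine Finset.sum_congr rfl fun i _ => ?_
  rw [← Finset.filter_ne, Finset.sum_filter]

theorem card_classPairs_self {Nbar : ℕ} {a : ℕ → Fin 2} {b : ℕ} {c : Fin 2} :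
    (classPairs Nbar a b c c).card =
      (batchClass Nbar a b c).card * ((batchClass Nbar a b c).card - 1) := by
  rw [Finset.card_eq_sum_ones, sum_classPairs (fun _ _ => 1)]
  rw [Finset.sum_congr rfl fun i hi => by
    rw [← Finset.card_eq_sum_ones, Finset.card_erase_of_mem hi]]
  simp

theorem batchClass_erase_of_ne {Nbar : ℕ} {a : ℕ → Fin 2} {b : ℕ} {c c' : Fin 2} (hc : c ≠ c')
    {i : ℕ} (hi : i ∈ batchClass Nbar a b c) :
    (batchClass Nbar a b c').erase i = batchClass Nbar a b c' := by
  refine Finset.erase_eq_of_notMem fun h => hc ?_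
  rw [← (Finset.mem_filter.1 hi).2, ← (Finset.mem_filter.1 h).2]

theorem card_classPairs_of_ne {Nbar : ℕ} {a : ℕ → Fin 2} {b : ℕ} {c c' : Fin 2} (hc : c ≠ c') :
    (classPairs Nbar a b c c').card =
      (batchClass Nbar a b c).card * (batchClass Nbar a b c').card := by
  rw [Finset.card_eq_sum_ones, sum_classPairs (fun _ _ => 1)]
  rw [Finset.sum_congr rfl fun i hi => by rw [batchClass_erase_of_ne hc hi]]
  simp

/-- The U-statistic averages over pairs of distinct samples. The sequence has to be recurrent for the
denominator `n * (n - 1)` to be the number of pairs, computed with truncated subtraction. -/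
theorem batchUnfairness_eq_pairMean {𝓧 Par : Type*} (Nbar : ℕ) (K : ℝ → ℝ → ℝ) (h : Par → 𝓧 → ℝ)
    (x : ℕ → 𝓧) {a : ℕ → Fin 2} (ha : RecurrentLabels a) (b : ℕ) (θ : Par) :
    batchUnfairness Nbar K h x a b θ =
      pairMean Nbar a b 0 0 (fun i j => K (h θ (x i)) (h θ (x j))) +
      pairMean Nbar a b 1 1 (fun i j => K (h θ (x i)) (h θ (x j))) -
      2 * pairMean Nbar a b 0 1 (fun i j => K (h θ (x i)) (h θ (x j))) := by
  have hself : ∀ c, pairMean Nbar a b c c (fun i j => K (h θ (x i)) (h θ (x j))) =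
      ∑ i ∈ batchClass Nbar a b c, ∑ j ∈ (batchClass Nbar a b c).erase i,
        K (h θ (x i)) (h θ (x j)) /
        (((batchClass Nbar a b c).card : ℝ) * (((batchClass Nbar a b c).card : ℝ) - 1)) := by
    intro c
    unfold pairMean
    rw [sum_classPairs (fun i j => ((classPairs Nbar a b c c).card : ℝ)⁻¹ *
      K (h θ (x i)) (h θ (x j))), card_classPairs_self]
    have h2 := ha.two_le_card_batchClass (Nbar := Nbar) b c
    rw [Nat.cast_mul, Nat.cast_sub (by omega), Nat.cast_one]
    simp only [div_eq_inv_mul]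
  have hne : pairMean Nbar a b 0 1 (fun i j => K (h θ (x i)) (h θ (x j))) =
      ∑ i ∈ batchClass Nbar a b 0, ∑ j ∈ batchClass Nbar a b 1,
        K (h θ (x i)) (h θ (x j)) /
          (((batchClass Nbar a b 0).card : ℝ) * ((batchClass Nbar a b 1).card : ℝ)) := by
    unfold pairMean
    rw [sum_classPairs (fun i j => ((classPairs Nbar a b 0 1).card : ℝ)⁻¹ *
      K (h θ (x i)) (h θ (x j))), card_classPairs_of_ne (by decide)]
    refine Finset.sum_congr rfl fun i hi => ?_
    rw [batchClass_erase_of_ne (by decide) hi, Nat.cast_mul]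
    simp only [div_eq_inv_mul]
  rw [hself, hself, hne]
  simp only [batchUnfairness, Fin.sum_univ_two]

theorem RecurrentLabels.card_classPairs_pos {a : ℕ → Fin 2} (ha : RecurrentLabels a) (Nbar b : ℕ)
    (c c' : Fin 2) : 0 < (classPairs Nbar a b c c').card := by
  have h1 := ha.two_le_card_batchClass (Nbar := Nbar) b c
  have h2 := ha.two_le_card_batchClass (Nbar := Nbar) b c'
  rcases eq_or_ne c c' with rfl | hc
  · rw [card_classPairs_self]
    exact Nat.mul_pos (by omega) (by omega)
  · rw [card_classPairs_of_ne hc]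
    exact Nat.mul_pos (by omega) (by omega)

theorem ofReal_sum_finset_eq_tsum {ι : Type*} (s : Finset ι) {w : ℝ} (hw : 0 ≤ w) {v : ι → ℝ}
    (hv : ∀ x, 0 ≤ v x) [DecidablePred (· ∈ s)] :
    ENNReal.ofReal (∑ x ∈ s, w * v x) =
      ∑' x, (if x ∈ s then ENNReal.ofReal w else 0) * ENNReal.ofReal (v x) := by
  rw [ENNReal.ofReal_sum_of_nonneg fun x _ => mul_nonneg hw (hv x), tsum_eq_sum (s := s)]
  · refine Finset.sum_congr rfl fun x hx => ?_
    rw [if_pos hx, ENNReal.ofReal_mul hw]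
  · intro x hx
    rw [if_neg hx, zero_mul]

/-- The weight of the `i`-th sample in the corrected average, if it belongs to class `c`. -/
def sampleWeight (Nbar b : ℕ) (c : Fin 2) (i : ℕ) (a : ℕ → Fin 2) : ENNReal :=
  if i ∈ batchClass Nbar a b c then
    ENNReal.ofReal (biasCorrection Nbar (batch Nbar a b).card (batchClass Nbar a b c).card /
      (batch Nbar a b).card) else 0

/-- The weight of a pair of samples in the average over the pairs of classes `c` and `c'`. -/
def pairWeight (Nbar b : ℕ) (c c' : Fin 2) (q : ℕ × ℕ) (a : ℕ → Fin 2) : ENNReal :=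
  if q ∈ classPairs Nbar a b c c' then
    ENNReal.ofReal ((classPairs Nbar a b c c').card : ℝ)⁻¹ else 0

theorem ofReal_correctedMean (Nbar : ℕ) (a : ℕ → Fin 2) (b : ℕ) {v : ℕ → ℝ} (hv : ∀ i, 0 ≤ v i) :
    ENNReal.ofReal (correctedMean Nbar a b v) =
      ∑ c : Fin 2, ∑' i, sampleWeight Nbar b c i a * ENNReal.ofReal (v i) := by
  have hw : ∀ c, 0 ≤ biasCorrection Nbar (batch Nbar a b).card (batchClass Nbar a b c).card /
      ((batch Nbar a b).card : ℝ) := fun c =>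
    div_nonneg (biasCorrection_nonneg _ _) (Nat.cast_nonneg _)
  have h1 : correctedMean Nbar a b v = ∑ c : Fin 2, ∑ i ∈ batchClass Nbar a b c,
      biasCorrection Nbar (batch Nbar a b).card (batchClass Nbar a b c).card /
      ((batch Nbar a b).card : ℝ) * v i := by
    unfold correctedMean
    rw [Finset.mul_sum]
    refine Finset.sum_congr rfl fun c _ => ?_
    rw [Finset.mul_sum]
    refine Finset.sum_congr rfl fun i _ => ?_
    ring
  rw [h1, ENNReal.ofReal_sum_of_nonneg fun c _ => Finset.sum_nonneg fun i _ =>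
    mul_nonneg (hw c) (hv i)]
  refine Finset.sum_congr rfl fun c _ => ?_
  rw [ofReal_sum_finset_eq_tsum _ (hw c) hv]
  rfl

theorem ofReal_pairMean (Nbar : ℕ) (a : ℕ → Fin 2) (b : ℕ) (c c' : Fin 2) {v : ℕ → ℕ → ℝ}
    (hv : ∀ i j, 0 ≤ v i j) :
    ENNReal.ofReal (pairMean Nbar a b c c' v) =
      ∑' q : ℕ × ℕ, pairWeight Nbar b c c' q a * ENNReal.ofReal (v q.1 q.2) := by
  exact ofReal_sum_finset_eq_tsum (classPairs Nbar a b c c')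
    (inv_nonneg.2 (Nat.cast_nonneg (classPairs Nbar a b c c').card))
    (v := fun q => v q.1 q.2) fun q => hv _ _

theorem measurable_sampleWeight (Nbar b : ℕ) (c : Fin 2) (i : ℕ) :
    Measurable (sampleWeight Nbar b c i) := by
  classical
  have h : Measurable fun a : ℕ → Fin 2 => (batchStart Nbar a b, batchStart Nbar a (b + 1)) :=
    (measurable_batchStart Nbar b).prodMk (measurable_batchStart Nbar (b + 1))
  refine measurable_comp_countable (G := fun (p : ℕ × ℕ) a =>
    if i ∈ (Finset.Ico p.1 p.2).filter (fun i => a i = c) then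
      ENNReal.ofReal (biasCorrection Nbar (Finset.Ico p.1 p.2).card (classCount a p.1 p.2 c) /
        (Finset.Ico p.1 p.2).card) else 0) h fun p => ?_
  refine Measurable.ite ?_ ?_ measurable_const
  · simp only [Finset.mem_filter]
    exact (MeasurableSet.const _).inter (measurableSet_label_eq i c)
  · exact (measurable_of_countable fun n : ℕ =>
      ENNReal.ofReal (biasCorrection Nbar (Finset.Ico p.1 p.2).card n /
        (Finset.Ico p.1 p.2).card)).comp (measurable_classCount p.1 p.2 c)

theorem measurableSet_mem_labelPairs (s t : ℕ) (c c' : Fin 2) (q : ℕ × ℕ) :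
    MeasurableSet {a : ℕ → Fin 2 | q ∈ labelPairs a s t c c'} := by
  simp only [labelPairs, Finset.mem_filter, Finset.mem_product]
  exact (((MeasurableSet.const _).inter (measurableSet_label_eq q.1 c)).inter
    ((MeasurableSet.const _).inter (measurableSet_label_eq q.2 c'))).inter (MeasurableSet.const _)

theorem measurable_card_labelPairs (s t : ℕ) (c c' : Fin 2) :
    Measurable fun a : ℕ → Fin 2 => (labelPairs a s t c c').card := by
  have hcard : ∀ a : ℕ → Fin 2, (labelPairs a s t c c').card =
      ∑ r ∈ Finset.Ico s t ×ˢ Finset.Ico s t, if r ∈ labelPairs a s t c c' then 1 else 0 := by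
    intro a
    have hsub : labelPairs a s t c c' ⊆ Finset.Ico s t ×ˢ Finset.Ico s t :=
      (Finset.filter_subset _ _).trans
        (Finset.product_subset_product (Finset.filter_subset _ _) (Finset.filter_subset _ _))
    rw [Finset.sum_ite_mem, Finset.inter_eq_right.2 hsub, Finset.card_eq_sum_ones]
  simp_rw [hcard]
  exact Finset.measurable_sum _ fun r _ =>
    Measurable.ite (measurableSet_mem_labelPairs s t c c' r) measurable_const measurable_const

theorem measurable_pairWeight (Nbar b : ℕ) (c c' : Fin 2) (q : ℕ × ℕ) :
    Measurable (pairWeight Nbar b c c' q) := by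
  have h : Measurable fun a : ℕ → Fin 2 => (batchStart Nbar a b, batchStart Nbar a (b + 1)) :=
    (measurable_batchStart Nbar b).prodMk (measurable_batchStart Nbar (b + 1))
  refine measurable_comp_countable (G := fun (p : ℕ × ℕ) a =>
    if q ∈ labelPairs a p.1 p.2 c c' then
      ENNReal.ofReal ((labelPairs a p.1 p.2 c c').card : ℝ)⁻¹ else 0) h fun p => ?_
  exact Measurable.ite (measurableSet_mem_labelPairs _ _ _ _ _)
    ((measurable_of_countable fun n : ℕ => ENNReal.ofReal (n : ℝ)⁻¹).comp
      (measurable_card_labelPairs _ _ _ _)) measurable_const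

theorem sampleWeight_ne_zero {Nbar b : ℕ} {c : Fin 2} {i : ℕ} {a : ℕ → Fin 2}
    (h : sampleWeight Nbar b c i a ≠ 0) : a i = c := by
  by_contra hne
  have : i ∉ batchClass Nbar a b c := fun hi => hne (Finset.mem_filter.1 hi).2
  exact h (if_neg this)

theorem pairWeight_ne_zero {Nbar b : ℕ} {c c' : Fin 2} {q : ℕ × ℕ} {a : ℕ → Fin 2}
    (h : pairWeight Nbar b c c' q a ≠ 0) : q.1 ≠ q.2 ∧ a q.1 = c ∧ a q.2 = c' := by
  by_contra hne
  refine h (if_neg fun hq => hne ?_)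
  have h1 := Finset.mem_filter.1 hq
  have h2 := Finset.mem_product.1 h1.1
  exact ⟨h1.2, (Finset.mem_filter.1 h2.1).2, (Finset.mem_filter.1 h2.2).2⟩

theorem RecurrentLabels.tsum_sampleWeight {Nbar : ℕ} (hNbar : 4 ≤ Nbar) {a : ℕ → Fin 2}
    (ha : RecurrentLabels a) (b : ℕ) (c : Fin 2) : ∑' i, sampleWeight Nbar b c i a =
      ENNReal.ofReal (classCount a (batchStart Nbar a b) (windowEnd Nbar a b) c /
        ((windowEnd Nbar a b - batchStart Nbar a b : ℕ) : ℝ)) := by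
  have h1 := ofReal_sum_finset_eq_tsum (batchClass Nbar a b c)
    (w := biasCorrection Nbar (batch Nbar a b).card (batchClass Nbar a b c).card /
      ((batch Nbar a b).card : ℝ)) (v := fun _ => 1)
    (div_nonneg (biasCorrection_nonneg _ _) (Nat.cast_nonneg _)) fun _ => zero_le_one
  simp only [ENNReal.ofReal_one, mul_one, Finset.sum_const, nsmul_eq_mul] at h1
  rw [← ha.card_mul_biasCorrection b hNbar c, mul_div_assoc, h1]
  rfl

theorem RecurrentLabels.tsum_pairWeight {a : ℕ → Fin 2} (ha : RecurrentLabels a) (Nbar b : ℕ)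
    (c c' : Fin 2) : ∑' q, pairWeight Nbar b c c' q a = 1 := by
  have h1 := ofReal_pairMean Nbar a b c c' (v := fun _ _ => 1) fun _ _ => zero_le_one
  simp only [ENNReal.ofReal_one, mul_one, pairMean, Finset.sum_const, nsmul_eq_mul] at h1
  have h2 : ((classPairs Nbar a b c c').card : ℝ) ≠ 0 := by
    exact_mod_cast (ha.card_classPairs_pos Nbar b c c').ne'
  rw [← h1, mul_inv_cancel₀ h2, ENNReal.ofReal_one]

/-- A positive linear functional of functions whose expectation agrees with an integral on the
nonnegative functions agrees with it on all integrable functions. -/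
theorem integral_eq_of_lintegral_eq {S Ω : Type*} [MeasurableSpace S] [MeasurableSpace Ω]
    {ρ : Measure S} {P : Measure Ω} (T : (S → ℝ) → Ω → ℝ)
    (hsub : ∀ f g ω, T (fun z => f z - g z) ω = T f ω - T g ω)
    (hnonneg : ∀ f, (∀ z, 0 ≤ f z) → ∀ ω, 0 ≤ T f ω)
    (hmeas : ∀ f, Measurable f → (∀ z, 0 ≤ f z) → Measurable (T f))
    (hlint : ∀ f, Measurable f → (∀ z, 0 ≤ f z) →
      ∫⁻ ω, ENNReal.ofReal (T f ω) ∂P = ∫⁻ z, ENNReal.ofReal (f z) ∂ρ)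
    {f : S → ℝ} (hf : Measurable f) (hfi : Integrable f ρ) :
    Integrable (T f) P ∧ ∫ ω, T f ω ∂P = ∫ z, f z ∂ρ := by
  have hpos : ∀ f, Measurable f → (∀ z, 0 ≤ f z) → Integrable f ρ →
      Integrable (T f) P ∧ ∫ ω, T f ω ∂P = ∫ z, f z ∂ρ := by
    intro f hf h0 hfi
    constructor
    · refine ⟨(hmeas f hf h0).aestronglyMeasurable, ?_⟩
      rw [hasFiniteIntegral_iff_ofReal (Filter.Eventually.of_forall (hnonneg f h0)), hlint f hf h0,
        ← hasFiniteIntegral_iff_ofReal (Filter.Eventually.of_forall h0)]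
      exact hfi.2
    · rw [integral_eq_lintegral_of_nonneg_ae (Filter.Eventually.of_forall (hnonneg f h0))
        (hmeas f hf h0).aestronglyMeasurable, hlint f hf h0,
        ← integral_eq_lintegral_of_nonneg_ae (Filter.Eventually.of_forall h0)
        hf.aestronglyMeasurable]
  have h1 := hpos (fun z => max (f z) 0) (hf.max measurable_const) (fun z => le_max_right _ _)
    hfi.pos_part
  have h2 := hpos (fun z => max (-f z) 0) (hf.neg.max measurable_const) (fun z => le_max_right _ _)
    hfi.neg_part
  have hfeq : f = fun z => max (f z) 0 - max (-f z) 0 := by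
    funext z
    rcases le_total 0 (f z) with h | h
    · simp [h]
    · simp [h]
  have hT : T f = fun ω => T (fun z => max (f z) 0) ω - T (fun z => max (-f z) 0) ω := by
    funext ω
    conv_lhs => rw [hfeq]
    rw [hsub]
  constructor
  · rw [hT]; exact h1.1.sub h2.1
  · rw [hT, integral_sub h1.1 h2.1, h1.2, h2.2, ← integral_sub hfi.pos_part hfi.neg_part, ← hfeq]

/-- Expectation of a weighted sum whose weights depend on the labels only: conditionally on the
labels `v x` of the samples in `J x`, the summand `F x` has the same expectation for all `x`. -/
theorem lintegral_tsum_labels_mul {Ω S ι : Type*} [MeasurableSpace Ω] {P : Measure Ω}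
    [MeasurableSpace S] [Countable ι] {Z : ℕ → Ω → S}
    (hZ : ∀ i, Measurable (Z i)) (hindep : iIndepFun Z P) {g : S → Fin 2} (hg : Measurable g)
    (T : Set ι) (J : ι → Finset ℕ) (v : ι → ℕ → Fin 2) {W : ι → (ℕ → Fin 2) → ENNReal}
    (hW : ∀ x, Measurable (W x))
    (hWv : ∀ x a, W x a ≠ 0 → x ∈ T ∧ ∀ i ∈ J x, a i = v x i) {F : ι → Ω → ENNReal}
    (hF : ∀ x, Measurable[⨆ i ∈ (J x : Set ℕ), MeasurableSpace.comap (Z i) inferInstance] (F x))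
    {π κ : ENNReal} (hπ : ∀ x ∈ T, P {ω | ∀ i ∈ J x, g (Z i ω) = v x i} = π)
    (hκ : ∀ x ∈ T, ∫⁻ ω in {ω | ∀ i ∈ J x, g (Z i ω) = v x i}, F x ω ∂P = κ) :
    (∫⁻ ω, ∑' x, W x (fun i => g (Z i ω)) * F x ω ∂P) * π =
      (∫⁻ ω, ∑' x, W x (fun i => g (Z i ω)) ∂P) * κ := by
  classical
  have hα : Measurable fun ω i => g (Z i ω) := measurable_pi_iff.2 fun i => hg.comp (hZ i)
  have hWα : ∀ x, Measurable fun ω => W x (fun i => g (Z i ω)) := fun x => (hW x).comp hα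
  have hle : ∀ x, ⨆ i ∈ (J x : Set ℕ), MeasurableSpace.comap (Z i) inferInstance ≤
      (inferInstance : MeasurableSpace Ω) := fun x => iSup₂_le fun i _ => (hZ i).comap_le
  have hFm : ∀ x, Measurable (F x) := fun x => (hF x).mono (hle x) le_rfl
  have hWF : ∀ x, Measurable fun ω => W x (fun i => g (Z i ω)) * F x ω := fun x =>
    (hWα x).mul (hFm x)
  rw [lintegral_tsum fun x => (hWF x).aemeasurable,
    lintegral_tsum fun x => (hWα x).aemeasurable, ← ENNReal.tsum_mul_right,
    ← ENNReal.tsum_mul_right]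
  refine tsum_congr fun x => ?_
  by_cases hx : x ∈ T
  swap
  · have h0 : ∀ a, W x a = 0 := fun a => by
      by_contra h
      exact hx (hWv x a h).1
    simp [h0]
  set B : Set Ω := {ω | ∀ i ∈ J x, g (Z i ω) = v x i}
  have hB : MeasurableSet[⨆ i ∈ (J x : Set ℕ), MeasurableSpace.comap (Z i) inferInstance] B := by
    have : B = ⋂ i ∈ J x, (fun ω => g (Z i ω)) ⁻¹' {v x i} := by
      ext ω; simp [B]
    rw [this]
    refine Finset.measurableSet_biInter _ fun i hi => ?_
    have h2 : Measurable[MeasurableSpace.comap (Z i) inferInstance] (Z i) := comap_measurable _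
    have h3 : MeasurableSpace.comap (Z i) inferInstance ≤
        ⨆ i ∈ (J x : Set ℕ), MeasurableSpace.comap (Z i) inferInstance :=
      le_iSup₂_of_le i hi le_rfl
    exact ((hg.comp h2).mono h3 le_rfl) (measurableSet_singleton _)
  have hBm : MeasurableSet B := hle x _ hB
  have key : ∀ F' : Ω → ENNReal,
      Measurable[⨆ i ∈ (J x : Set ℕ), MeasurableSpace.comap (Z i) inferInstance] F' →
      ∫⁻ ω, W x (fun i => g (Z i ω)) * F' ω ∂P =
      (∫⁻ ω, W x (fun i => if i ∈ J x then v x i else g (Z i ω)) ∂P) * ∫⁻ ω in B, F' ω ∂P := by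
    intro F' hF'
    rw [← lintegral_indicator hBm, ← lintegral_labels_mul hZ hindep hg (J x) (v x) (hW x)
      (hF'.indicator hB)]
    · refine lintegral_congr fun ω => ?_
      by_cases hω : ω ∈ B
      · rw [Set.indicator_of_mem hω]
      · have : W x (fun i => g (Z i ω)) = 0 := by
          by_contra h
          exact hω (hWv x _ h).2
        rw [this, zero_mul, zero_mul]
    · intro ω hω
      exact Set.mem_of_indicator_ne_zero hω
  have h1 := key (F x) (hF x)
  have h2 := key (fun _ => 1) measurable_const
  simp only [mul_one, lintegral_const, one_mul, Measure.restrict_apply_univ] at h2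
  rw [h1, h2, hκ x hx, hπ x hx]
  ring

/-! ### Unbiasedness of the batch averages -/

theorem measurable_comap_of_mem {Ω S β : Type*} [MeasurableSpace S] [MeasurableSpace β]
    {Z : ℕ → Ω → S} {J : Finset ℕ} {i : ℕ} (hi : i ∈ J) {u : S → β} (hu : Measurable u) :
    Measurable[⨆ i ∈ (J : Set ℕ), MeasurableSpace.comap (Z i) inferInstance]
      fun ω => u (Z i ω) := by
  have h2 : Measurable[MeasurableSpace.comap (Z i) inferInstance] (Z i) := comap_measurable _
  have h3 : MeasurableSpace.comap (Z i) inferInstance ≤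
      ⨆ i ∈ (J : Set ℕ), MeasurableSpace.comap (Z i) inferInstance :=
    le_iSup₂_of_le i (by simpa using hi) le_rfl
  exact (hu.comp h2).mono h3 le_rfl

section Samples

variable {Ω 𝓧 : Type*} [MeasurableSpace Ω] [MeasurableSpace 𝓧] {P : Measure Ω} {X : Ω → 𝓧} {Y : Ω → ℝ} {A : Ω → Fin 2}
  {Xs : ℕ → Ω → 𝓧} {Ys : ℕ → Ω → ℝ} {As : ℕ → Ω → Fin 2}

/-- The distribution of the features conditional on the class. -/
def featureLaw (P : Measure Ω) (X : Ω → 𝓧) (A : Ω → Fin 2) (c : Fin 2) : Measure 𝓧 :=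
  (P[|A ⁻¹' {c}]).map X

theorem isProbabilityMeasure_featureLaw [IsFiniteMeasure P] (hX : Measurable X)
    (hpos : ∀ a : Fin 2, 0 < P (A ⁻¹' {a})) (c : Fin 2) :
    IsProbabilityMeasure (featureLaw P X A c) := by
  have := cond_isProbabilityMeasure (μ := P) (hpos c).ne'
  exact Measure.isProbabilityMeasure_map hX.aemeasurable

theorem lintegral_featureLaw [IsFiniteMeasure P] (hX : Measurable X) (hA : Measurable A)
    (hpos : ∀ a : Fin 2, 0 < P (A ⁻¹' {a})) (c : Fin 2) {f : 𝓧 → ENNReal} (hf : Measurable f) :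
    P (A ⁻¹' {c}) * ∫⁻ x, f x ∂(featureLaw P X A c) =
      ∫⁻ ω, (if A ω = c then f (X ω) else 0) ∂P := by
  have hAc : MeasurableSet (A ⁻¹' {c}) := hA (measurableSet_singleton c)
  have h1 : (fun ω => if A ω = c then f (X ω) else 0) =
      (A ⁻¹' {c}).indicator fun ω => f (X ω) := by
    funext ω
    simp [Set.indicator]
  unfold featureLaw
  rw [h1, lintegral_indicator hAc, lintegral_map hf hX, ProbabilityTheory.cond,
    lintegral_smul_measure, smul_eq_mul, ← mul_assoc,
    ENNReal.mul_inv_cancel (hpos c).ne' (measure_ne_top _ _), one_mul]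

variable (hX : Measurable X) (hY : Measurable Y) (hA : Measurable A)
  (hpos : ∀ a : Fin 2, 0 < P (A ⁻¹' {a}))
  (hXs : ∀ i, Measurable (Xs i)) (hYs : ∀ i, Measurable (Ys i)) (hAs : ∀ i, Measurable (As i))
  (hindep : iIndepFun (fun i ω => (Xs i ω, Ys i ω, As i ω)) P)
  (hident : ∀ i, IdentDistrib (fun ω => (Xs i ω, Ys i ω, As i ω))
    (fun ω => (X ω, Y ω, A ω)) P P)

include hident in
theorem measure_label_eq (i : ℕ) (c : Fin 2) : P (As i ⁻¹' {c}) = P (A ⁻¹' {c}) := by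
  have h := (hident i).comp (u := fun z : 𝓧 × ℝ × Fin 2 => z.2.2) (by fun_prop)
  exact h.measure_mem_eq (measurableSet_singleton c)

include hindep in
theorem iIndepFun_labels : iIndepFun As P :=
  hindep.comp (fun _ z => z.2.2) fun _ => by fun_prop

include hAs hindep hident hpos in
theorem ae_recurrentLabels_samples [IsProbabilityMeasure P] : ∀ᵐ ω ∂P, RecurrentLabels fun i => As i ω :=
  ae_recurrentLabels hAs (iIndepFun_labels hindep) (measure_label_eq hident)
    fun c => (hpos c).ne'

variable [IsProbabilityMeasure P]

include hX hY hA hpos hXs hYs hAs hindep hident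

/-- The bias-corrected batch average is an unbiased estimator of the expectation. -/
theorem integral_correctedMean {Nbar : ℕ} (hNbar : 4 ≤ Nbar) (b : ℕ) {f : 𝓧 × ℝ → ℝ}
    (hf : Measurable f)
    (hfi : Integrable (fun ω => f (X ω, Y ω)) P) :
    Integrable (fun ω => correctedMean Nbar (fun i => As i ω) b fun i => f (Xs i ω, Ys i ω)) P ∧
      ∫ ω, correctedMean Nbar (fun i => As i ω) b (fun i => f (Xs i ω, Ys i ω)) ∂P =
        ∫ ω, f (X ω, Y ω) ∂P := by
  have hXY : Measurable fun ω => (X ω, Y ω) := hX.prodMk hY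
  have hZ : ∀ i, Measurable fun ω => (Xs i ω, Ys i ω, As i ω) := fun i =>
    (hXs i).prodMk ((hYs i).prodMk (hAs i))
  have hα : Measurable fun ω i => As i ω := measurable_pi_iff.2 hAs
  have hterm : ∀ f : 𝓧 × ℝ → ℝ, Measurable f → ∀ c, Measurable fun ω =>
      ∑' i, sampleWeight Nbar b c i (fun i => As i ω) * ENNReal.ofReal (f (Xs i ω, Ys i ω)) := by
    intro f hf c
    refine Measurable.tsum fun i => ?_
    exact ((measurable_sampleWeight Nbar b c i).comp hα).mul
      (hf.comp ((hXs i).prodMk (hYs i))).ennreal_ofReal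
  have hlint : ∀ f : 𝓧 × ℝ → ℝ, Measurable f → ∀ c,
      ∫⁻ ω, ∑' i, sampleWeight Nbar b c i (fun i => As i ω) *
        ENNReal.ofReal (f (Xs i ω, Ys i ω)) ∂P =
      ∫⁻ ω in A ⁻¹' {c}, ENNReal.ofReal (f (X ω, Y ω)) ∂P := by
    intro f hf c
    have hAc : MeasurableSet (A ⁻¹' {c}) := hA (measurableSet_singleton c)
    have key := lintegral_tsum_labels_mul hZ hindep (g := fun z => z.2.2) (by fun_prop)
      Set.univ (fun i : ℕ => {i}) (fun _ _ => c) (W := sampleWeight Nbar b c)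
      (F := fun i ω => ENNReal.ofReal (f (Xs i ω, Ys i ω))) (π := P (A ⁻¹' {c}))
      (κ := ∫⁻ ω in A ⁻¹' {c}, ENNReal.ofReal (f (X ω, Y ω)) ∂P)
      (fun i => measurable_sampleWeight Nbar b c i)
      (fun i a h => ⟨Set.mem_univ _, fun j hj => by
        rw [Finset.mem_singleton.1 hj]; exact sampleWeight_ne_zero h⟩)
      (fun i => measurable_comap_of_mem (J := {i})
        (u := fun z : 𝓧 × ℝ × Fin 2 => ENNReal.ofReal (f (z.1, z.2.1)))
        (Finset.mem_singleton_self i) (by fun_prop))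
      (fun i _ => by
        rw [← measure_label_eq hident i c]
        congr 1
        ext ω
        simp)
      (fun i _ => by
        have hset : {ω | ∀ j ∈ ({i} : Finset ℕ), As j ω = c} = As i ⁻¹' {c} := by
          ext ω; simp
        change ∫⁻ ω in {ω | ∀ j ∈ ({i} : Finset ℕ), As j ω = c}, _ ∂P = _
        rw [hset, ← lintegral_indicator (hAs i (measurableSet_singleton c)),
          ← lintegral_indicator hAc]
        have hu : Measurable fun z : 𝓧 × ℝ × Fin 2 =>
            ({z | z.2.2 = c} : Set (𝓧 × ℝ × Fin 2)).indicator
              (fun z => ENNReal.ofReal (f (z.1, z.2.1))) z := by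
          refine Measurable.indicator (by fun_prop) ?_
          exact measurableSet_eq_fun (by fun_prop) measurable_const
        exact ((hident i).comp hu).lintegral_eq)
    have hwin := lintegral_windowFrequency hAs (iIndepFun_labels hindep)
      (measure_label_eq hident) (fun c => (hpos c).ne') (by omega : 0 < Nbar) b c
    have hW : ∫⁻ ω, ∑' i, sampleWeight Nbar b c i (fun i => As i ω) ∂P = P (A ⁻¹' {c}) := by
      rw [← hwin]
      refine lintegral_congr_ae ?_
      filter_upwards [ae_recurrentLabels_samples hpos hAs hindep hident] with ω hω
      exact hω.tsum_sampleWeight hNbar b c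
    change (∫⁻ ω, ∑' i, sampleWeight Nbar b c i (fun i => As i ω) *
        ENNReal.ofReal (f (Xs i ω, Ys i ω)) ∂P) * _ =
      (∫⁻ ω, ∑' i, sampleWeight Nbar b c i (fun i => As i ω) ∂P) * _ at key
    rw [hW, mul_comm] at key
    exact (ENNReal.mul_right_inj (hpos c).ne' (measure_ne_top _ _)).1 key
  have := integral_eq_of_lintegral_eq (ρ := P.map fun ω => (X ω, Y ω)) (P := P)
    (fun f ω => correctedMean Nbar (fun i => As i ω) b fun i => f (Xs i ω, Ys i ω))
    ?_ ?_ ?_ ?_ hf ((integrable_map_measure hf.aestronglyMeasurable hXY.aemeasurable).2 hfi)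
  · rwa [integral_map hXY.aemeasurable hf.aestronglyMeasurable] at this
  · intro f g ω
    simp only [correctedMean, mul_sub, Finset.sum_sub_distrib]
  · intro f hf ω
    unfold correctedMean
    exact mul_nonneg (by positivity) (Finset.sum_nonneg fun c _ => Finset.sum_nonneg fun i _ =>
      mul_nonneg (biasCorrection_nonneg _ _) (hf _))
  · intro f hf h0
    have h1 : (fun ω => correctedMean Nbar (fun i => As i ω) b fun i => f (Xs i ω, Ys i ω)) =
        fun ω => (∑ c : Fin 2, ∑' i, sampleWeight Nbar b c i (fun i => As i ω) *
          ENNReal.ofReal (f (Xs i ω, Ys i ω))).toReal := by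
      funext ω
      rw [← ofReal_correctedMean Nbar _ b fun i => h0 _, ENNReal.toReal_ofReal]
      unfold correctedMean
      exact mul_nonneg (by positivity) (Finset.sum_nonneg fun c _ => Finset.sum_nonneg fun i _ =>
        mul_nonneg (biasCorrection_nonneg _ _) (h0 _))
    rw [h1]
    exact (Finset.measurable_sum _ fun c _ => hterm f hf c).ennreal_toReal
  · intro f hf h0
    simp_rw [ofReal_correctedMean Nbar _ b fun i => h0 _]
    rw [lintegral_finsetSum _ fun c _ => hterm f hf c, Fin.sum_univ_two, hlint f hf, hlint f hf,
      lintegral_map hf.ennreal_ofReal hXY]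
    have hcompl : A ⁻¹' {1} = (A ⁻¹' {0})ᶜ := by
      ext ω
      have : ∀ x : Fin 2, x = 1 ↔ ¬ x = 0 := by decide
      simp [this]
    rw [hcompl, lintegral_add_compl _ (hA (measurableSet_singleton 0))]

omit hpos in
theorem lintegral_sample_pair {i j : ℕ} (hij : i ≠ j)
    {u : (𝓧 × ℝ × Fin 2) × (𝓧 × ℝ × Fin 2) → ENNReal}
    (hu : Measurable u) :
    ∫⁻ ω, u ((Xs i ω, Ys i ω, As i ω), (Xs j ω, Ys j ω, As j ω)) ∂P =
      ∫⁻ ω, ∫⁻ ω', u ((X ω, Y ω, A ω), (X ω', Y ω', A ω')) ∂P ∂P := by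
  have hZ : ∀ i, Measurable fun ω => (Xs i ω, Ys i ω, As i ω) := fun i =>
    (hXs i).prodMk ((hYs i).prodMk (hAs i))
  have hZ' : Measurable fun ω => (X ω, Y ω, A ω) := hX.prodMk (hY.prodMk hA)
  have h1 := (indepFun_iff_map_prod_eq_prod_map_map (hZ i).aemeasurable
    (hZ j).aemeasurable).1 (hindep.indepFun hij)
  rw [(hident i).map_eq, (hident j).map_eq] at h1
  have h2 : ∫⁻ ω, u ((Xs i ω, Ys i ω, As i ω), (Xs j ω, Ys j ω, As j ω)) ∂P =
      ∫⁻ z, u z ∂(P.map fun ω => ((Xs i ω, Ys i ω, As i ω), (Xs j ω, Ys j ω, As j ω))) :=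
    (lintegral_map hu ((hZ i).prodMk (hZ j))).symm
  rw [h2, h1, lintegral_prod _ hu.aemeasurable, lintegral_map hu.lintegral_prod_right' hZ']
  refine lintegral_congr fun ω => ?_
  exact lintegral_map (f := fun z => u ((X ω, Y ω, A ω), z)) (hu.comp measurable_prodMk_left) hZ'

/-- The expectation over two samples with prescribed labels is, up to the probabilities of these labels,
the integral against the product of the class-conditional feature distributions. -/
theorem lintegral_pair_labels {i j : ℕ} (hij : i ≠ j) (c c' : Fin 2) {f : 𝓧 × 𝓧 → ENNReal}
    (hf : Measurable f) :
    ∫⁻ ω in {ω | As i ω = c ∧ As j ω = c'}, f (Xs i ω, Xs j ω) ∂P =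
      P (A ⁻¹' {c}) * P (A ⁻¹' {c'}) *
        ∫⁻ z, f z ∂((featureLaw P X A c).prod (featureLaw P X A c')) := by
  have := isProbabilityMeasure_featureLaw hX hpos c
  have := isProbabilityMeasure_featureLaw hX hpos c'
  have hms : MeasurableSet {ω | As i ω = c ∧ As j ω = c'} :=
    (hAs i (measurableSet_singleton c)).inter (hAs j (measurableSet_singleton c'))
  rw [← lintegral_indicator hms]
  have hu : Measurable fun z : (𝓧 × ℝ × Fin 2) × (𝓧 × ℝ × Fin 2) =>
      if z.1.2.2 = c then (if z.2.2.2 = c' then f (z.1.1, z.2.1) else 0) else 0 := by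
    refine Measurable.ite (measurableSet_eq_fun (by fun_prop) measurable_const)
      (Measurable.ite (measurableSet_eq_fun (by fun_prop) measurable_const) (by fun_prop)
        measurable_const) measurable_const
  have h1 := lintegral_sample_pair hX hY hA hXs hYs hAs hindep hident hij hu
  have h2 : ∀ ω, {ω | As i ω = c ∧ As j ω = c'}.indicator (fun ω => f (Xs i ω, Xs j ω)) ω =
      if As i ω = c then (if As j ω = c' then f (Xs i ω, Xs j ω) else 0) else 0 := by
    intro ω
    simp only [Set.indicator, Set.mem_ofPred_eq]
    split_ifs <;> simp_all
  simp_rw [h2]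
  refine h1.trans ?_
  have h3 : ∀ ω, ∫⁻ ω', (if A ω = c then (if A ω' = c' then f (X ω, X ω') else 0) else 0) ∂P =
      if A ω = c then P (A ⁻¹' {c'}) * ∫⁻ y, f (X ω, y) ∂(featureLaw P X A c') else 0 := by
    intro ω
    split_ifs
    · exact (lintegral_featureLaw hX hA hpos c' (f := fun y => f (X ω, y)) (by fun_prop)).symm
    · simp
  have h4 : Measurable fun x => P (A ⁻¹' {c'}) * ∫⁻ y, f (x, y) ∂(featureLaw P X A c') :=
    hf.lintegral_prod_right'.const_mul _
  calc ∫⁻ ω, ∫⁻ ω', (if A ω = c then (if A ω' = c' then f (X ω, X ω') else 0) else 0) ∂P ∂P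
      = P (A ⁻¹' {c}) * ∫⁻ x, P (A ⁻¹' {c'}) * ∫⁻ y, f (x, y) ∂(featureLaw P X A c')
          ∂(featureLaw P X A c) := by
        rw [lintegral_featureLaw hX hA hpos c h4]
        exact lintegral_congr h3
    _ = _ := by
        rw [lintegral_const_mul _ hf.lintegral_prod_right', lintegral_prod _ hf.aemeasurable,
          mul_assoc]

theorem measure_pair_labels {i j : ℕ} (hij : i ≠ j) (c c' : Fin 2) :
    P {ω | As i ω = c ∧ As j ω = c'} = P (A ⁻¹' {c}) * P (A ⁻¹' {c'}) := by
  have := isProbabilityMeasure_featureLaw hX hpos c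
  have := isProbabilityMeasure_featureLaw hX hpos c'
  have h := lintegral_pair_labels hX hY hA hpos hXs hYs hAs hindep hident hij c c'
    (f := fun _ => 1) measurable_const
  simpa using h

/-- An integrability property of one pair of samples passes to every pair of classes. -/
theorem lintegral_featureLaw_prod_lt_top {f : 𝓧 × 𝓧 → ENNReal} (hf : Measurable f)
    (hfin : ∫⁻ ω, f (Xs 0 ω, Xs 1 ω) ∂P < ⊤) (c c' : Fin 2) :
    ∫⁻ z, f z ∂((featureLaw P X A c).prod (featureLaw P X A c')) < ⊤ := by
  have h := lintegral_pair_labels hX hY hA hpos hXs hYs hAs hindep hident zero_ne_one c c' hf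
  have h1 : P (A ⁻¹' {c}) * P (A ⁻¹' {c'}) *
      ∫⁻ z, f z ∂((featureLaw P X A c).prod (featureLaw P X A c')) < ⊤ := by
    rw [← h]
    exact (setLIntegral_le_lintegral _ _).trans_lt hfin
  refine lt_top_iff_ne_top.2 fun htop => ?_
  rw [htop, ENNReal.mul_top (mul_ne_zero (hpos c).ne' (hpos c').ne')] at h1
  exact lt_irrefl _ h1

omit hpos in
theorem ae_sample_pair_lt_top {f : 𝓧 × 𝓧 → ENNReal} (hf : Measurable f)
    (hfin : ∫⁻ ω, f (Xs 0 ω, Xs 1 ω) ∂P < ⊤) :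
    ∀ᵐ ω ∂P, ∀ i j, i ≠ j → f (Xs i ω, Xs j ω) < ⊤ := by
  rw [ae_all_iff]
  intro i
  rw [ae_all_iff]
  intro j
  by_cases hij : i = j
  · exact Filter.Eventually.of_forall fun ω h => absurd hij h
  have hu : Measurable fun z : (𝓧 × ℝ × Fin 2) × (𝓧 × ℝ × Fin 2) => f (z.1.1, z.2.1) := by
    fun_prop
  have h1 := lintegral_sample_pair hX hY hA hXs hYs hAs hindep hident hij hu
  have h2 := lintegral_sample_pair hX hY hA hXs hYs hAs hindep hident zero_ne_one hu
  have h3 : ∫⁻ ω, f (Xs i ω, Xs j ω) ∂P < ⊤ := (h1.trans h2.symm).trans_lt hfin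
  filter_upwards [ae_lt_top (hf.comp ((hXs i).prodMk (hXs j))) h3.ne] with ω hω _ using hω

/-- The average over the pairs of distinct samples of two classes is an unbiased estimator of the
expectation with respect to the product of the feature distributions of these classes. -/
theorem integral_pairMean (Nbar b : ℕ) (c c' : Fin 2) {f : 𝓧 × 𝓧 → ℝ} (hf : Measurable f)
    (hfi : Integrable f ((featureLaw P X A c).prod (featureLaw P X A c'))) :
    Integrable (fun ω => pairMean Nbar (fun i => As i ω) b c c' fun i j => f (Xs i ω, Xs j ω)) P ∧
      ∫ ω, pairMean Nbar (fun i => As i ω) b c c' (fun i j => f (Xs i ω, Xs j ω)) ∂P =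
        ∫ z, f z ∂((featureLaw P X A c).prod (featureLaw P X A c')) := by
  have hZ : ∀ i, Measurable fun ω => (Xs i ω, Ys i ω, As i ω) := fun i =>
    (hXs i).prodMk ((hYs i).prodMk (hAs i))
  have hα : Measurable fun ω i => As i ω := measurable_pi_iff.2 hAs
  have hnonneg : ∀ f : 𝓧 × 𝓧 → ℝ, (∀ z, 0 ≤ f z) → ∀ ω,
      0 ≤ pairMean Nbar (fun i => As i ω) b c c' fun i j => f (Xs i ω, Xs j ω) :=
    fun f h0 ω => Finset.sum_nonneg fun q _ =>
      mul_nonneg (inv_nonneg.2 (Nat.cast_nonneg _)) (h0 _)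
  refine integral_eq_of_lintegral_eq
    (fun f ω => pairMean Nbar (fun i => As i ω) b c c' fun i j => f (Xs i ω, Xs j ω))
    ?_ hnonneg ?_ ?_ hf hfi
  · intro f g ω
    simp only [pairMean, mul_sub, Finset.sum_sub_distrib]
  · intro f hf h0
    have h1 : (fun ω => pairMean Nbar (fun i => As i ω) b c c' fun i j => f (Xs i ω, Xs j ω)) =
        fun ω => (∑' q : ℕ × ℕ, pairWeight Nbar b c c' q (fun i => As i ω) *
          ENNReal.ofReal (f (Xs q.1 ω, Xs q.2 ω))).toReal := by
      funext ω
      rw [← ofReal_pairMean Nbar _ b c c' (v := fun i j => f (Xs i ω, Xs j ω)) fun i j => h0 _,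
        ENNReal.toReal_ofReal (hnonneg f h0 ω)]
    rw [h1]
    refine (Measurable.tsum fun q => ?_).ennreal_toReal
    exact ((measurable_pairWeight Nbar b c c' q).comp hα).mul
      (hf.comp ((hXs q.1).prodMk (hXs q.2))).ennreal_ofReal
  · intro f hf h0
    simp_rw [ofReal_pairMean Nbar _ b c c' (v := fun i j => f (Xs i _, Xs j _)) fun i j => h0 _]
    have key := lintegral_tsum_labels_mul hZ hindep (g := fun z => z.2.2) (by fun_prop)
      {q : ℕ × ℕ | q.1 ≠ q.2} (fun q : ℕ × ℕ => {q.1, q.2})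
      (fun q i => if i = q.1 then c else c') (W := pairWeight Nbar b c c')
      (F := fun q ω => ENNReal.ofReal (f (Xs q.1 ω, Xs q.2 ω)))
      (π := P (A ⁻¹' {c}) * P (A ⁻¹' {c'}))
      (κ := P (A ⁻¹' {c}) * P (A ⁻¹' {c'}) *
        ∫⁻ z, ENNReal.ofReal (f z) ∂((featureLaw P X A c).prod (featureLaw P X A c')))
      (fun q => measurable_pairWeight Nbar b c c' q)
      (fun q a h => by
        obtain ⟨h1, h2, h3⟩ := pairWeight_ne_zero h
        refine ⟨h1, fun i hi => ?_⟩
        rcases Finset.mem_insert.1 hi with rfl | hi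
        · simpa using h2
        · rw [Finset.mem_singleton.1 hi, if_neg h1.symm, h3])
      (fun q => by
        have hm : ∀ i ∈ ({q.1, q.2} : Finset ℕ), Measurable[⨆ i ∈ (({q.1, q.2} : Finset ℕ) : Set ℕ),
            MeasurableSpace.comap (fun ω => (Xs i ω, Ys i ω, As i ω)) inferInstance]
            fun ω => Xs i ω := fun i hi =>
          measurable_comap_of_mem (Z := fun i ω => (Xs i ω, Ys i ω, As i ω)) hi
            (u := fun z : 𝓧 × ℝ × Fin 2 => z.1) measurable_fst
        exact (hf.comp ((hm q.1 (by simp)).prodMk (hm q.2 (by simp)))).ennreal_ofReal)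
      (fun q hq => by
        rw [← measure_pair_labels hX hY hA hpos hXs hYs hAs hindep hident hq c c']
        congr 1
        ext ω
        have hq' : q.2 ≠ q.1 := Ne.symm hq
        simp [hq'])
      (fun q hq => by
        have hq' : q.2 ≠ q.1 := Ne.symm hq
        have hset : {ω | ∀ i ∈ ({q.1, q.2} : Finset ℕ), As i ω = if i = q.1 then c else c'} =
            {ω | As q.1 ω = c ∧ As q.2 ω = c'} := by
          ext ω; simp [hq']
        change ∫⁻ ω in {ω | ∀ i ∈ ({q.1, q.2} : Finset ℕ), As i ω = if i = q.1 then c else c'},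
          _ ∂P = _
        rw [hset]
        exact lintegral_pair_labels hX hY hA hpos hXs hYs hAs hindep hident hq c c'
          (f := fun z => ENNReal.ofReal (f z)) hf.ennreal_ofReal)
    have hW : ∫⁻ ω, ∑' q, pairWeight Nbar b c c' q (fun i => As i ω) ∂P = 1 := by
      have : ∫⁻ ω, ∑' q, pairWeight Nbar b c c' q (fun i => As i ω) ∂P = ∫⁻ _, 1 ∂P := by
        refine lintegral_congr_ae ?_
        filter_upwards [ae_recurrentLabels_samples hpos hAs hindep hident] with ω hω
        exact hω.tsum_pairWeight Nbar b c c'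
      rw [this, lintegral_one, measure_univ]
    change (∫⁻ ω, ∑' q : ℕ × ℕ, pairWeight Nbar b c c' q (fun i => As i ω) *
        ENNReal.ofReal (f (Xs q.1 ω, Xs q.2 ω)) ∂P) * _ =
      (∫⁻ ω, ∑' q, pairWeight Nbar b c c' q (fun i => As i ω) ∂P) * _ at key
    rw [hW, one_mul, mul_comm] at key
    exact (ENNReal.mul_right_inj (mul_ne_zero (hpos c).ne' (hpos c').ne')
      (ENNReal.mul_ne_top (measure_ne_top _ _) (measure_ne_top _ _))).1 key

end Samples

/-! ### Positivity of the squared maximum mean discrepancy -/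

section

variable {S : Type*} [MeasurableSpace S] {π : Measure S} [IsProbabilityMeasure π]

/-- Averaging the double sum over `n` independent points gives
`n * ∫ k(z, z) + n * (n - 1) * ∬ k ≥ 0`. -/
theorem integral_kernel_nonneg_of_integrable_diag {k : S × S → ℝ} (hk : Measurable k)
    (hpsd : ∀ (n : ℕ) (z : Fin n → S), 0 ≤ ∑ i, ∑ j, k (z i, z j))
    (hki : Integrable k (π.prod π)) (hdiag : Integrable (fun z => k (z, z)) π) :
    0 ≤ ∫ z, k z ∂(π.prod π) := by
  set κ := ∫ z, k z ∂(π.prod π)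
  set d := ∫ z, k (z, z) ∂π
  have key : ∀ n : ℕ, 0 ≤ (n : ℝ) * d + n * (n - 1) * κ := by
    intro n
    let ν : Measure (Fin n → S) := Measure.pi fun _ => π
    have hmp : ∀ i : Fin n, MeasurePreserving (fun z : Fin n → S => z i) ν π := fun i =>
      measurePreserving_eval (fun _ : Fin n => π) i
    have hind : iIndepFun (fun (i : Fin n) (z : Fin n → S) => z i) ν :=
      iIndepFun_pi (X := fun _ => id) fun i => aemeasurable_id
    have hpair : ∀ i j : Fin n, i ≠ j →
        MeasurePreserving (fun z : Fin n → S => (z i, z j)) ν (π.prod π) := by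
      intro i j hij
      refine ⟨(hmp i).measurable.prodMk (hmp j).measurable, ?_⟩
      have h1 := (indepFun_iff_map_prod_eq_prod_map_map (hmp i).measurable.aemeasurable
        (hmp j).measurable.aemeasurable).1 (hind.indepFun hij)
      rw [h1, (hmp i).map_eq, (hmp j).map_eq]
    have hval : ∀ i j : Fin n, Integrable (fun z : Fin n → S => k (z i, z j)) ν ∧
        ∫ z, k (z i, z j) ∂ν = if i = j then d else κ := by
      intro i j
      split_ifs with hij
      · subst hij
        refine ⟨(hmp i).integrable_comp_of_integrable hdiag, ?_⟩
        rw [← integral_map (hmp i).measurable.aemeasurable (f := fun x => k (x, x))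
          ((hmp i).map_eq ▸ hdiag.aestronglyMeasurable), (hmp i).map_eq]
      · refine ⟨(hpair i j hij).integrable_comp_of_integrable hki, ?_⟩
        rw [← integral_map (hpair i j hij).measurable.aemeasurable hk.aestronglyMeasurable,
          (hpair i j hij).map_eq]
    have h0 : 0 ≤ ∫ z, ∑ i, ∑ j, k (z i, z j) ∂ν := integral_nonneg fun z => hpsd n z
    rw [integral_finsetSum _ fun i _ => integrable_finsetSum _ fun j _ => (hval i j).1] at h0
    have hrow : ∀ i : Fin n, ∫ z, ∑ j, k (z i, z j) ∂ν = d + (n - 1) * κ := by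
      intro i
      rw [integral_finsetSum _ fun j _ => (hval i j).1,
        Finset.sum_congr rfl fun j _ => (hval i j).2]
      have : ∀ j : Fin n, (if i = j then d else κ) = κ + if i = j then d - κ else 0 := by
        intro j; split_ifs <;> ring
      simp only [this, Finset.sum_add_distrib, Finset.sum_const, Finset.card_univ,
        Fintype.card_fin, nsmul_eq_mul, Finset.sum_ite_eq, Finset.mem_univ, if_true]
      ring
    rw [Finset.sum_congr rfl fun i _ => hrow i] at h0
    simp only [Finset.sum_const, Finset.card_univ, Fintype.card_fin, nsmul_eq_mul] at h0
    linarith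
  by_contra hneg
  push Not at hneg
  obtain ⟨n, hn⟩ := exists_nat_gt (d / (-κ))
  rw [div_lt_iff₀ (by linarith)] at hn
  have h1 := key (n + 1)
  push_cast at h1
  have h2 : (0 : ℝ) < n + 1 := by positivity
  nlinarith

/-- A positive semidefinite kernel has a nonnegative double integral. The diagonal need not be
integrable, so the kernel is first truncated to the sets where its diagonal is bounded. -/
theorem integral_kernel_nonneg {k : S × S → ℝ} (hk : Measurable k)
    (hpsd : ∀ (n : ℕ) (z : Fin n → S) (c : Fin n → ℝ), 0 ≤ ∑ i, ∑ j, c i * c j * k (z i, z j))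
    (hki : Integrable k (π.prod π)) : 0 ≤ ∫ z, k z ∂(π.prod π) := by
  set B : ℕ → Set S := fun M => {z | k (z, z) ≤ M}
  have hB : ∀ M, MeasurableSet (B M) := fun M =>
    measurableSet_le (hk.comp (measurable_id.prodMk measurable_id)) measurable_const
  set χ : ℕ → S → ℝ := fun M => (B M).indicator 1
  have hχ : ∀ M, Measurable (χ M) := fun M => measurable_one.indicator (hB M)
  have hχ01 : ∀ M z, χ M z = 0 ∨ χ M z = 1 := fun M z => by
    by_cases h : z ∈ B M
    · right; simp [χ, h]
    · left; simp [χ, h]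
  have hle : ∀ M z, ‖χ M z.1 * χ M z.2 * k z‖ ≤ ‖k z‖ := fun M z => by
    rcases hχ01 M z.1 with h | h <;> rcases hχ01 M z.2 with h' | h' <;> simp [h, h']
  have hm : ∀ M, Measurable fun z : S × S => χ M z.1 * χ M z.2 * k z := fun M =>
    (((hχ M).comp measurable_fst).mul ((hχ M).comp measurable_snd)).mul hk
  have hnn : ∀ M, 0 ≤ ∫ z, χ M z.1 * χ M z.2 * k z ∂(π.prod π) := by
    intro M
    refine integral_kernel_nonneg_of_integrable_diag (hm M)
      (fun n z => hpsd n z fun i => χ M (z i))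
      (hki.mono (hm M).aestronglyMeasurable (Filter.Eventually.of_forall (hle M))) ?_
    refine Integrable.of_bound ((hm M).comp
      (measurable_id.prodMk measurable_id)).aestronglyMeasurable (M : ℝ)
      (Filter.Eventually.of_forall fun z => ?_)
    have h0 : 0 ≤ k (z, z) := by simpa using hpsd 1 (fun _ => z) fun _ => 1
    change ‖χ M z * χ M z * k (z, z)‖ ≤ M
    by_cases h : z ∈ B M
    · have : χ M z = 1 := by simp [χ, h]
      rw [this, one_mul, one_mul, Real.norm_of_nonneg h0]
      exact h
    · have : χ M z = 0 := by simp [χ, h]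
      simp [this]
  have hlim : Filter.Tendsto (fun M => ∫ z, χ M z.1 * χ M z.2 * k z ∂(π.prod π)) Filter.atTop
      (𝓝 (∫ z, k z ∂(π.prod π))) := by
    refine tendsto_integral_of_dominated_convergence (fun z => ‖k z‖)
      (fun M => (hm M).aestronglyMeasurable) hki.norm
      (fun M => Filter.Eventually.of_forall (hle M)) (Filter.Eventually.of_forall fun z => ?_)
    have hev : ∀ x : S, ∀ᶠ M : ℕ in Filter.atTop, χ M x = 1 := fun x => by
      obtain ⟨N, hN⟩ := exists_nat_ge (k (x, x))
      filter_upwards [Filter.eventually_ge_atTop N] with M hM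
      have : x ∈ B M := hN.trans (by exact_mod_cast hM)
      simp [χ, this]
    refine tendsto_const_nhds.congr' ?_
    filter_upwards [hev z.1, hev z.2] with M h1 h2
    rw [h1, h2, one_mul, one_mul]
  exact ge_of_tendsto' hlim hnn

end

/-- The radicand in the definition of the maximum mean discrepancy is nonnegative: it is the double
integral of the kernel `K u u' - K u v' - K v u' + K v v'` on pairs. -/
theorem IsPosDefKernel.mmd_sq {K : ℝ → ℝ → ℝ} (hK : IsPosDefKernel K)
    (hKm : Measurable fun p : ℝ × ℝ => K p.1 p.2) {Q₁ Q₂ : Measure ℝ} [IsProbabilityMeasure Q₁]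
    [IsProbabilityMeasure Q₂] (h11 : Integrable (fun p : ℝ × ℝ => K p.1 p.2) (Q₁.prod Q₁))
    (h22 : Integrable (fun p : ℝ × ℝ => K p.1 p.2) (Q₂.prod Q₂))
    (h12 : Integrable (fun p : ℝ × ℝ => K p.1 p.2) (Q₁.prod Q₂)) :
    mmd K Q₁ Q₂ ^ 2 = (∫ p, K p.1 p.2 ∂(Q₁.prod Q₁)) + (∫ p, K p.1 p.2 ∂(Q₂.prod Q₂))
      - 2 * ∫ p, K p.1 p.2 ∂(Q₁.prod Q₂) := by
  unfold mmd
  refine Real.sq_sqrt ?_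
  have h21 : Integrable (fun p : ℝ × ℝ => K p.1 p.2) (Q₂.prod Q₁) := by
    have := h12.swap
    refine this.congr (Filter.Eventually.of_forall fun p => hK.1 _ _)
  have hsymm : ∫ p, K p.1 p.2 ∂(Q₂.prod Q₁) = ∫ p, K p.1 p.2 ∂(Q₁.prod Q₂) := by
    rw [← integral_prod_swap]
    exact integral_congr_ae (Filter.Eventually.of_forall fun p => hK.1 _ _)
  let π : Measure (ℝ × ℝ) := Q₁.prod Q₂
  have hfst : MeasurePreserving (Prod.fst : ℝ × ℝ → ℝ) π Q₁ := measurePreserving_fst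
  have hsnd : MeasurePreserving (Prod.snd : ℝ × ℝ → ℝ) π Q₂ := measurePreserving_snd
  have hint : ∀ {f g : ℝ × ℝ → ℝ} {μ ν : Measure ℝ} [IsProbabilityMeasure μ]
      [IsProbabilityMeasure ν], MeasurePreserving f π μ → MeasurePreserving g π ν →
      Integrable (fun p : ℝ × ℝ => K p.1 p.2) (μ.prod ν) →
      Integrable (fun z : (ℝ × ℝ) × (ℝ × ℝ) => K (f z.1) (g z.2)) (π.prod π) ∧
      ∫ z, K (f z.1) (g z.2) ∂(π.prod π) = ∫ p, K p.1 p.2 ∂(μ.prod ν) := by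
    intro f g μ ν _ _ hf hg hi
    have hfg := hf.prod hg
    refine ⟨hfg.integrable_comp_of_integrable hi, ?_⟩
    rw [← hfg.map_eq, integral_map hfg.measurable.aemeasurable hKm.aestronglyMeasurable]
    rfl
  obtain ⟨i11, e11⟩ := hint hfst hfst h11
  obtain ⟨i12, e12⟩ := hint hfst hsnd h12
  obtain ⟨i21, e21⟩ := hint hsnd hfst h21
  obtain ⟨i22, e22⟩ := hint hsnd hsnd h22
  have hKm' : ∀ {f g : (ℝ × ℝ) × (ℝ × ℝ) → ℝ}, Measurable f → Measurable g →
      Measurable fun z => K (f z) (g z) := fun hf hg => hKm.comp (hf.prodMk hg)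
  have key := integral_kernel_nonneg (π := π)
    (k := fun z => K z.1.1 z.2.1 - K z.1.1 z.2.2 - K z.1.2 z.2.1 + K z.1.2 z.2.2)
    ((((hKm' (by fun_prop) (by fun_prop)).sub (hKm' (by fun_prop) (by fun_prop))).sub
      (hKm' (by fun_prop) (by fun_prop))).add (hKm' (by fun_prop) (by fun_prop)))
    (fun n z c => by
      have h := hK.2 (n + n) (Fin.append (fun i => (z i).1) fun i => (z i).2)
        (Fin.append c fun i => -c i)
      simp only [Fin.sum_univ_add, Fin.append_left, Fin.append_right] at h
      rw [← Finset.sum_add_distrib] at h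
      refine h.trans_eq (Finset.sum_congr rfl fun i _ => ?_)
      rw [← Finset.sum_add_distrib, ← Finset.sum_add_distrib, ← Finset.sum_add_distrib]
      exact Finset.sum_congr rfl fun j _ => by ring)
    (((i11.sub i12).sub i21).add i22)
  have hsplit : ∫ z : (ℝ × ℝ) × (ℝ × ℝ), (K z.1.1 z.2.1 - K z.1.1 z.2.2 - K z.1.2 z.2.1 +
      K z.1.2 z.2.2) ∂(π.prod π) = (∫ p, K p.1 p.2 ∂(Q₁.prod Q₁)) -
      (∫ p, K p.1 p.2 ∂(Q₁.prod Q₂)) - (∫ p, K p.1 p.2 ∂(Q₂.prod Q₁)) +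
      ∫ p, K p.1 p.2 ∂(Q₂.prod Q₂) := by
    have i1 : Integrable (fun z : (ℝ × ℝ) × (ℝ × ℝ) => K z.1.1 z.2.1 - K z.1.1 z.2.2) (π.prod π) :=
      i11.sub i12
    have i2 : Integrable (fun z : (ℝ × ℝ) × (ℝ × ℝ) => K z.1.1 z.2.1 - K z.1.1 z.2.2 -
        K z.1.2 z.2.1) (π.prod π) := i1.sub i21
    rw [integral_add i2 i22, integral_sub i1 i21,
      integral_sub i11 i12, e11, e12, e21, e22]
  rw [hsplit, hsymm] at key
  linarith

/-! ### The batch estimators as random functions of the parameter -/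

theorem LocallyLipschitz.comp_lipschitzOnWith {E F : Type*} [PseudoEMetricSpace E]
    [PseudoEMetricSpace F] {g : F → ℝ} {u : E → F} {Θ : Set E} {C : NNReal}
    (hg : LocallyLipschitz g) (hu : LipschitzOnWith C u Θ) :
    LocallyLipschitzOn Θ fun θ => g (u θ) := by
  intro θ hθ
  obtain ⟨K, t, ht, hK⟩ := hg (u θ)
  refine ⟨K * C, Θ ∩ u ⁻¹' t, ?_, hK.comp (hu.mono Set.inter_subset_left)
    fun x hx => hx.2⟩
  exact Filter.inter_mem self_mem_nhdsWithin (hu.continuousOn θ hθ ht)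

theorem abs_correctedMean_sub_le (Nbar : ℕ) (a : ℕ → Fin 2) (b : ℕ) {v w g : ℕ → ℝ} {t : ℝ}
    (h : ∀ i, |v i - w i| ≤ g i * t) :
    |correctedMean Nbar a b v - correctedMean Nbar a b w| ≤ correctedMean Nbar a b g * t := by
  unfold correctedMean
  rw [← mul_sub, abs_mul, abs_of_nonneg (by positivity : (0 : ℝ) ≤ 1 / ((batch Nbar a b).card : ℝ)),
    mul_assoc]
  refine mul_le_mul_of_nonneg_left ?_ (by positivity)
  rw [← Finset.sum_sub_distrib, Finset.sum_mul]
  refine (Finset.abs_sum_le_sum_abs _ _).trans (Finset.sum_le_sum fun c _ => ?_)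
  rw [← Finset.sum_sub_distrib, Finset.sum_mul]
  refine (Finset.abs_sum_le_sum_abs _ _).trans (Finset.sum_le_sum fun i _ => ?_)
  rw [← mul_sub, abs_mul, abs_of_nonneg (biasCorrection_nonneg _ _), mul_assoc]
  exact mul_le_mul_of_nonneg_left (h i) (biasCorrection_nonneg _ _)

theorem abs_pairMean_sub_le (Nbar : ℕ) (a : ℕ → Fin 2) (b : ℕ) (c c' : Fin 2)
    {v w g : ℕ → ℕ → ℝ} {t : ℝ} (h : ∀ i j, i ≠ j → |v i j - w i j| ≤ g i j * t) :
    |pairMean Nbar a b c c' v - pairMean Nbar a b c c' w| ≤ pairMean Nbar a b c c' g * t := by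
  unfold pairMean
  rw [← Finset.sum_sub_distrib, Finset.sum_mul]
  refine (Finset.abs_sum_le_sum_abs _ _).trans (Finset.sum_le_sum fun q hq => ?_)
  rw [← mul_sub, abs_mul, abs_of_nonneg (inv_nonneg.2 (Nat.cast_nonneg _)), mul_assoc]
  exact mul_le_mul_of_nonneg_left (h _ _ (Finset.mem_filter.1 hq).2)
    (inv_nonneg.2 (Nat.cast_nonneg _))

section Differentiability

variable {𝓧 Par : Type*} [NormedAddCommGroup Par] [NormedSpace ℝ Par]

theorem differentiableAt_batchRisk (Nbar : ℕ) {L : ℝ → ℝ → ℝ} {h : Par → 𝓧 → ℝ} {x : ℕ → 𝓧}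
    {y : ℕ → ℝ} (a : ℕ → Fin 2) (b : ℕ) {θ : Par}
    (hd : ∀ i, DifferentiableAt ℝ (fun θ => L (h θ (x i)) (y i)) θ) :
    DifferentiableAt ℝ (batchRisk Nbar L h x y a b) θ := by
  unfold batchRisk
  exact (DifferentiableAt.fun_sum fun c _ => DifferentiableAt.fun_sum fun i _ =>
    (hd i).const_mul _).const_mul _

theorem differentiableAt_batchUnfairness (Nbar : ℕ) {K : ℝ → ℝ → ℝ} {h : Par → 𝓧 → ℝ}
    {x : ℕ → 𝓧} (a : ℕ → Fin 2) (b : ℕ) {θ : Par}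
    (hd : ∀ i j, DifferentiableAt ℝ (fun θ => K (h θ (x i)) (h θ (x j))) θ) :
    DifferentiableAt ℝ (batchUnfairness Nbar K h x a b) θ := by
  unfold batchUnfairness
  simp only [div_eq_mul_inv]
  exact (DifferentiableAt.fun_sum fun c _ => DifferentiableAt.fun_sum fun i _ =>
    DifferentiableAt.fun_sum fun j _ => (hd i j).mul_const _).sub
    ((DifferentiableAt.fun_sum fun i _ => DifferentiableAt.fun_sum fun j _ =>
      (hd i j).mul_const _).const_mul _)

end Differentiability

section Objective

variable {Ω 𝓧 Par : Type*} [MeasurableSpace Ω] [MeasurableSpace 𝓧] {P : Measure Ω} {X : Ω → 𝓧} {Y : Ω → ℝ} {A : Ω → Fin 2}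
  {Xs : ℕ → Ω → 𝓧} {Ys : ℕ → Ω → ℝ} {As : ℕ → Ω → Fin 2}
  (hX : Measurable X) (hY : Measurable Y) (hA : Measurable A)
  (hpos : ∀ a : Fin 2, 0 < P (A ⁻¹' {a}))
  (hXs : ∀ i, Measurable (Xs i)) (hYs : ∀ i, Measurable (Ys i)) (hAs : ∀ i, Measurable (As i))
  (hindep : iIndepFun (fun i ω => (Xs i ω, Ys i ω, As i ω)) P)
  (hident : ∀ i, IdentDistrib (fun ω => (Xs i ω, Ys i ω, As i ω))
    (fun ω => (X ω, Y ω, A ω)) P P)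
  {h : Par → 𝓧 → ℝ} {θ : Par} (hh : Measurable (h θ))
  {L K : ℝ → ℝ → ℝ}

include hX hh in
theorem groupLaw_eq_map_featureLaw (a : Fin 2) :
    groupLaw P A (fun ω => h θ (X ω)) a = (featureLaw P X A a).map (h θ) :=
  (Measure.map_map hh hX).symm

variable [IsProbabilityMeasure P]

include hX hh hpos in
theorem groupLaw_prod_eq_map (a a' : Fin 2) :
    (groupLaw P A (fun ω => h θ (X ω)) a).prod (groupLaw P A (fun ω => h θ (X ω)) a') =
      ((featureLaw P X A a).prod (featureLaw P X A a')).map (Prod.map (h θ) (h θ)) := by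
  have := isProbabilityMeasure_featureLaw hX hpos a
  have := isProbabilityMeasure_featureLaw hX hpos a'
  rw [groupLaw_eq_map_featureLaw hX hh, groupLaw_eq_map_featureLaw hX hh,
    Measure.map_prod_map _ _ hh hh]

include hX hY hA hpos hXs hYs hAs hindep hident hh

/-- The batch risk is an unbiased estimator of the expected loss. -/
theorem integral_batchRisk (hLm : Measurable fun p : ℝ × ℝ => L p.1 p.2)
    (hLi : Integrable (fun ω => L (h θ (X ω)) (Y ω)) P) {Nbar : ℕ} (hNbar : 4 ≤ Nbar) (b : ℕ) :
    Integrable (fun ω => batchRisk Nbar L h (fun i => Xs i ω) (fun i => Ys i ω)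
        (fun i => As i ω) b θ) P ∧
      ∫ ω, batchRisk Nbar L h (fun i => Xs i ω) (fun i => Ys i ω) (fun i => As i ω) b θ ∂P =
        ∫ ω, L (h θ (X ω)) (Y ω) ∂P :=
  integral_correctedMean hX hY hA hpos hXs hYs hAs hindep hident hNbar b
    (f := fun z => L (h θ z.1) z.2)
    (hLm.comp ((hh.comp measurable_fst).prodMk measurable_snd)) hLi

/-- The batch unfairness is an unbiased estimator of the squared maximum mean discrepancy. -/
theorem integral_batchUnfairness (hK : IsPosDefKernel K)
    (hKm : Measurable fun p : ℝ × ℝ => K p.1 p.2)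
    (hKi : ∀ a a' : Fin 2, Integrable (fun p : ℝ × ℝ => K p.1 p.2)
      ((groupLaw P A (fun ω => h θ (X ω)) a).prod (groupLaw P A (fun ω => h θ (X ω)) a')))
    (Nbar b : ℕ) :
    Integrable (fun ω => batchUnfairness Nbar K h (fun i => Xs i ω) (fun i => As i ω) b θ) P ∧
      ∫ ω, batchUnfairness Nbar K h (fun i => Xs i ω) (fun i => As i ω) b θ ∂P =
        mmd K (groupLaw P A (fun ω => h θ (X ω)) 0) (groupLaw P A (fun ω => h θ (X ω)) 1) ^ 2 := by
  have hprob : ∀ a, IsProbabilityMeasure (groupLaw P A (fun ω => h θ (X ω)) a) := fun a => by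
    have := isProbabilityMeasure_featureLaw hX hpos a
    rw [groupLaw_eq_map_featureLaw hX hh]
    exact Measure.isProbabilityMeasure_map hh.aemeasurable
  have := hprob 0
  have := hprob 1
  have hhm : Measurable (Prod.map (h θ) (h θ)) := hh.prodMap hh
  have hpm : ∀ c c' : Fin 2,
      Integrable (fun ω => pairMean Nbar (fun i => As i ω) b c c'
        fun i j => K (h θ (Xs i ω)) (h θ (Xs j ω))) P ∧
      ∫ ω, pairMean Nbar (fun i => As i ω) b c c'
        (fun i j => K (h θ (Xs i ω)) (h θ (Xs j ω))) ∂P =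
      ∫ p, K p.1 p.2 ∂((groupLaw P A (fun ω => h θ (X ω)) c).prod
        (groupLaw P A (fun ω => h θ (X ω)) c')) := by
    intro c c'
    have hi := hKi c c'
    rw [groupLaw_prod_eq_map hX hpos hh] at hi ⊢
    rw [integral_map hhm.aemeasurable hKm.aestronglyMeasurable]
    exact integral_pairMean hX hY hA hpos hXs hYs hAs hindep hident Nbar b c c'
      (f := fun z => K (h θ z.1) (h θ z.2)) (hKm.comp hhm)
      ((integrable_map_measure hKm.aestronglyMeasurable hhm.aemeasurable).1 hi)
  have heq : (fun ω => batchUnfairness Nbar K h (fun i => Xs i ω) (fun i => As i ω) b θ) =ᵐ[P]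
      fun ω => pairMean Nbar (fun i => As i ω) b 0 0
          (fun i j => K (h θ (Xs i ω)) (h θ (Xs j ω))) +
        pairMean Nbar (fun i => As i ω) b 1 1 (fun i j => K (h θ (Xs i ω)) (h θ (Xs j ω))) -
        2 * pairMean Nbar (fun i => As i ω) b 0 1
          (fun i j => K (h θ (Xs i ω)) (h θ (Xs j ω))) := by
    filter_upwards [ae_recurrentLabels_samples hpos hAs hindep hident] with ω hω
    exact batchUnfairness_eq_pairMean Nbar K h (fun i => Xs i ω) hω b θ
  have i1 : Integrable (fun ω => pairMean Nbar (fun i => As i ω) b 0 0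
      (fun i j => K (h θ (Xs i ω)) (h θ (Xs j ω))) +
      pairMean Nbar (fun i => As i ω) b 1 1 (fun i j => K (h θ (Xs i ω)) (h θ (Xs j ω)))) P :=
    (hpm 0 0).1.add (hpm 1 1).1
  have i2 := (hpm 0 1).1.const_mul 2
  refine ⟨(i1.sub i2).congr heq.symm, ?_⟩
  rw [integral_congr_ae heq, integral_sub i1 i2, integral_add (hpm 0 0).1 (hpm 1 1).1,
    integral_const_mul, (hpm 0 0).2, (hpm 1 1).2, (hpm 0 1).2,
    hK.mmd_sq hKm (hKi 0 0) (hKi 1 1) (hKi 0 1)]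

end Objective

/-! ### Differentiation under the expectation -/

/-- A random function with an integrable random Lipschitz constant near `θ`, almost surely
differentiable at `θ`, may be differentiated under the expectation. -/
theorem hasGradientAt_integral_of_lipschitz {Ω : Type*} [MeasurableSpace Ω] {P : Measure Ω} {m : ℕ}
    {F : EuclideanSpace ℝ (Fin m) → Ω → ℝ} {F' : Ω → EuclideanSpace ℝ (Fin m)}
    {θ : EuclideanSpace ℝ (Fin m)} {S : Set (EuclideanSpace ℝ (Fin m))} {bound : Ω → ℝ}
    (hS : S ∈ 𝓝 θ) (hF : ∀ ϑ ∈ S, Integrable (F ϑ) P)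
    (hlip : ∀ᵐ ω ∂P, ∀ ϑ ∈ S, |F ϑ ω - F θ ω| ≤ bound ω * ‖ϑ - θ‖) (hbound : Integrable bound P)
    (hd : ∀ᵐ ω ∂P, HasGradientAt (fun ϑ => F ϑ ω) (F' ω) θ) :
    Integrable F' P ∧ HasGradientAt (fun ϑ => ∫ ω, F ϑ ω ∂P) (∫ ω, F' ω ∂P) θ := by
  let T := InnerProductSpace.toDual ℝ (EuclideanSpace ℝ (Fin m))
  have hd' : ∀ᵐ ω ∂P, HasFDerivAt (fun ϑ => F ϑ ω) (T (F' ω)) θ := by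
    filter_upwards [hd] with ω hω using hω.hasFDerivAt
  have hm := aestronglyMeasurable_fderiv_of_ae
    (Filter.eventually_of_mem hS fun ϑ hϑ => (hF ϑ hϑ).aestronglyMeasurable) hd'
  obtain ⟨h1, h2⟩ := hasFDerivAt_integral_of_dominated_loc_of_lip' hS
    (fun ϑ hϑ => (hF ϑ hϑ).aestronglyMeasurable) (hF θ (mem_of_mem_nhds hS)) hm
    (by simpa only [Real.norm_eq_abs] using hlip) hbound hd'
  have h3 : Integrable F' P := by
    have := T.symm.toContinuousLinearEquiv.toContinuousLinearMap.integrable_comp h1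
    simpa using this
  refine ⟨h3, ?_⟩
  rw [hasGradientAt_iff_hasFDerivAt]
  have h4 : ∫ ω, T (F' ω) ∂P = T (∫ ω, F' ω ∂P) :=
    T.toContinuousLinearEquiv.toContinuousLinearMap.integral_comp_comm h3
  rwa [h4] at h2

end

theorem theorem2
    {Ω : Type*} [MeasurableSpace Ω] (P : Measure Ω) [IsProbabilityMeasure P]
    {d m : ℕ} (𝓧 : Set (EuclideanSpace ℝ (Fin d))) (h𝓧 : MeasurableSet 𝓧)
    -- features, output, protected attribute
    (X : Ω → 𝓧) (Y : Ω → ℝ) (A : Ω → Fin 2)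
    (hX : Measurable X) (hY : Measurable Y) (hA : Measurable A)
    (hpos : ∀ a : Fin 2, 0 < P (A ⁻¹' {a}))
    -- i.i.d. training samples with the distribution of `(X, Y, A)`
    (Xs : ℕ → Ω → 𝓧) (Ys : ℕ → Ω → ℝ) (As : ℕ → Ω → Fin 2)
    (hXs : ∀ i, Measurable (Xs i)) (hYs : ∀ i, Measurable (Ys i)) (hAs : ∀ i, Measurable (As i))
    (hindep : iIndepFun (fun i ω => (Xs i ω, Ys i ω, As i ω)) P)
    (hident : ∀ i, IdentDistrib (fun ω => (Xs i ω, Ys i ω, As i ω))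
      (fun ω => (X ω, Y ω, A ω)) P P)
    -- parametric hypotheses
    (Θ : Set (EuclideanSpace ℝ (Fin m))) (hΘ : IsOpen Θ)
    (h : EuclideanSpace ℝ (Fin m) → 𝓧 → ℝ)
    (hlip_x : ∀ θ ∈ Θ, ∃ C, LipschitzWith C (h θ))
    (hlip_θ : ∀ x, ∃ C, LipschitzOnWith C (fun θ => h θ x) Θ)
    -- loss function
    (L : ℝ → ℝ → ℝ) (hL_nonneg : ∀ u y, 0 ≤ L u y)
    (hL_lsc : LowerSemicontinuous (fun p : ℝ × ℝ => L p.1 p.2))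
    (hL_convex : ∀ y, ConvexOn ℝ Set.univ (fun u => L u y))
    -- kernel
    (K : ℝ → ℝ → ℝ) (hK : IsPosDefKernel K)
    -- the expected loss and the integrals that define the MMD are finite
    (hL_int : ∀ θ ∈ Θ, Integrable (fun ω => L (h θ (X ω)) (Y ω)) P)
    (hK_int : ∀ θ ∈ Θ, ∀ a a' : Fin 2, Integrable (fun p : ℝ × ℝ => K p.1 p.2)
      ((groupLaw P A (fun ω => h θ (X ω)) a).prod (groupLaw P A (fun ω => h θ (X ω)) a')))
    (lam : ℝ) (hlam : 0 ≤ lam)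
    (hreg : UniformGradientIntegrability P Θ h L K (Xs 0) (Xs 1) (Ys 0))
    -- target batch size and number of the batch
    (Nbar : ℕ) (hNbar : 4 ≤ Nbar) (b : ℕ) :
    -- the gradient estimator is unbiased wherever it exists with probability one
    (∀ θ ∈ Θ,
      (∀ᵐ ω ∂P,
        DifferentiableAt ℝ
          (batchRisk Nbar L h (fun i => Xs i ω) (fun i => Ys i ω) (fun i => As i ω) b) θ ∧
        DifferentiableAt ℝ
          (batchUnfairness Nbar K h (fun i => Xs i ω) (fun i => As i ω) b) θ) →
      Integrable (fun ω =>
        gradient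
          (batchRisk Nbar L h (fun i => Xs i ω) (fun i => Ys i ω) (fun i => As i ω) b) θ +
        lam • gradient
          (batchUnfairness Nbar K h (fun i => Xs i ω) (fun i => As i ω) b) θ) P ∧
      HasGradientAt (fairObjective P X Y A L (mmd K) (fun z => lam * z ^ 2) h)
        (∫ ω, (gradient
            (batchRisk Nbar L h (fun i => Xs i ω) (fun i => Ys i ω) (fun i => As i ω) b) θ +
          lam • gradient
            (batchUnfairness Nbar K h (fun i => Xs i ω) (fun i => As i ω) b) θ) ∂P) θ) ∧
    -- and it exists with probability one at almost every parameter
    (∀ᵐ θ ∂(volume.restrict Θ), ∀ᵐ ω ∂P,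
      DifferentiableAt ℝ
        (batchRisk Nbar L h (fun i => Xs i ω) (fun i => Ys i ω) (fun i => As i ω) b) θ ∧
      DifferentiableAt ℝ
        (batchUnfairness Nbar K h (fun i => Xs i ω) (fun i => As i ω) b) θ) := by
  classical
  obtain ⟨-, hKpd, hgrad⟩ := hreg
  have hKcont : Continuous fun p : ℝ × ℝ => K p.1 p.2 := hKpd.1
  have hKm : Measurable fun p : ℝ × ℝ => K p.1 p.2 := hKcont.measurable
  have hLm : Measurable fun p : ℝ × ℝ => L p.1 p.2 := hL_lsc.measurable
  have hhm : ∀ θ ∈ Θ, Measurable (h θ) := fun θ hθ => by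
    obtain ⟨C, hC⟩ := hlip_x θ hθ
    exact hC.continuous.measurable
  -- the loss of a sample and the kernel of a pair of samples, as functions of the parameter
  set ℓ : EuclideanSpace ℝ (Fin m) → 𝓧 × ℝ → ℝ := fun θ z => L (h θ z.1) z.2
  set k : EuclideanSpace ℝ (Fin m) → 𝓧 × 𝓧 → ℝ := fun θ z => K (h θ z.1) (h θ z.2)
  have hℓm : ∀ θ ∈ Θ, Measurable (ℓ θ) := fun θ hθ =>
    hLm.comp (((hhm θ hθ).comp measurable_fst).prodMk measurable_snd)
  have hkm : ∀ θ ∈ Θ, Measurable (k θ) := fun θ hθ =>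
    hKm.comp (((hhm θ hθ).comp measurable_fst).prodMk ((hhm θ hθ).comp measurable_snd))
  have hℓlip : ∀ z, LocallyLipschitzOn Θ fun θ => ℓ θ z := fun z => by
    obtain ⟨C, hC⟩ := hlip_θ z.1
    exact (hL_convex z.2).locallyLipschitz.comp_lipschitzOnWith hC
  have hklip : ∀ z, LocallyLipschitzOn Θ fun θ => k θ z := fun z => by
    obtain ⟨C, hC⟩ := hlip_θ z.1
    obtain ⟨C', hC'⟩ := hlip_θ z.2
    exact hKpd.locallyLipschitz.comp_lipschitzOnWith (hC.prodMk hC')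
  refine ⟨fun θ hθ hd => ?_, ?_⟩
  swap
  · have h1 : ∀ i, ∀ᵐ θ ∂(volume.restrict Θ), ∀ᵐ ω ∂P,
        DifferentiableAt ℝ (fun θ => ℓ θ (Xs i ω, Ys i ω)) θ := fun i =>
      ae_ae_differentiableAt hΘ (fun θ hθ => (hℓm θ hθ).comp ((hXs i).prodMk (hYs i)))
        fun ω => hℓlip _
    have h2 : ∀ i j, ∀ᵐ θ ∂(volume.restrict Θ), ∀ᵐ ω ∂P,
        DifferentiableAt ℝ (fun θ => k θ (Xs i ω, Xs j ω)) θ := fun i j =>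
      ae_ae_differentiableAt hΘ (fun θ hθ => (hkm θ hθ).comp ((hXs i).prodMk (hXs j)))
        fun ω => hklip _
    filter_upwards [ae_all_iff.2 h1, ae_all_iff.2 fun i => ae_all_iff.2 (h2 i)] with θ h3 h4
    filter_upwards [ae_all_iff.2 h3, ae_all_iff.2 fun i => ae_all_iff.2 (h4 i)] with ω h5 h6
    exact ⟨differentiableAt_batchRisk Nbar _ b h5, differentiableAt_batchUnfairness Nbar _ b h6⟩
  -- a ball around `θ` on which the gradients have an integrable bound
  obtain ⟨Θ₀, hΘ₀, hsub, hK₀, hL₀⟩ := hgrad θ hθ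
  obtain ⟨r, hr, hball⟩ := Metric.mem_nhds_iff.1 hΘ₀
  set B := Metric.ball θ r
  have hBo : IsOpen B := Metric.isOpen_ball
  have hBc : Convex ℝ B := convex_ball θ r
  have hBΘ : B ⊆ Θ := hball.trans hsub
  have hθB : θ ∈ B := Metric.mem_ball_self hr
  set gL : 𝓧 × ℝ → ENNReal := fun z => lipModulus (fun ϑ => ℓ ϑ z) B
  set gK : 𝓧 × 𝓧 → ENNReal := fun z => lipModulus (fun ϑ => k ϑ z) B
  have hgLm : Measurable gL := measurable_lipModulus fun ϑ hϑ => hℓm ϑ (hBΘ hϑ)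
  have hgKm : Measurable gK := measurable_lipModulus fun ϑ hϑ => hkm ϑ (hBΘ hϑ)
  have hgL0 : ∫⁻ ω, gL (Xs 0 ω, Ys 0 ω) ∂P < ⊤ :=
    (lintegral_mono fun ω => lipModulus_le_supGradient hBo hBc hball
      ((hℓlip (Xs 0 ω, Ys 0 ω)).mono hBΘ)).trans_lt hL₀
  have hgK0 : ∫⁻ ω, gK (Xs 0 ω, Xs 1 ω) ∂P < ⊤ :=
    (lintegral_mono fun ω => lipModulus_le_supGradient hBo hBc hball
      ((hklip (Xs 0 ω, Xs 1 ω)).mono hBΘ)).trans_lt hK₀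
  have hgLi : ∀ i, ∫⁻ ω, gL (Xs i ω, Ys i ω) ∂P = ∫⁻ ω, gL (X ω, Y ω) ∂P := fun i =>
    ((hident i).comp (u := fun z : 𝓧 × ℝ × Fin 2 => gL (z.1, z.2.1)) (by fun_prop)).lintegral_eq
  have hgLtop : ∫⁻ ω, gL (X ω, Y ω) ∂P < ⊤ := hgLi 0 ▸ hgL0
  have hL_bound : ∀ z, gL z ≠ ⊤ → ∀ ϑ ∈ B, |ℓ ϑ z - ℓ θ z| ≤ (gL z).toReal * ‖ϑ - θ‖ := by
    intro z hz ϑ hϑ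
    have h1 := edist_le_lipModulus_mul hBo ((hℓlip z).mono hBΘ).continuousOn hz hϑ hθB
    have h2 := ENNReal.toReal_mono (ENNReal.mul_ne_top hz (edist_ne_top _ _)) h1
    rwa [ENNReal.toReal_mul, ← dist_edist, ← dist_edist, Real.dist_eq, dist_eq_norm] at h2
  have hK_bound : ∀ z, gK z ≠ ⊤ → ∀ ϑ ∈ B, |k ϑ z - k θ z| ≤ (gK z).toReal * ‖ϑ - θ‖ := by
    intro z hz ϑ hϑ
    have h1 := edist_le_lipModulus_mul hBo ((hklip z).mono hBΘ).continuousOn hz hϑ hθB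
    have h2 := ENNReal.toReal_mono (ENNReal.mul_ne_top hz (edist_ne_top _ _)) h1
    rwa [ENNReal.toReal_mul, ← dist_edist, ← dist_edist, Real.dist_eq, dist_eq_norm] at h2
  -- the random Lipschitz constant of the batch objective
  set α : Ω → ℕ → Fin 2 := fun ω i => As i ω
  set bL : Ω → ℝ := fun ω => correctedMean Nbar (α ω) b fun i => (gL (Xs i ω, Ys i ω)).toReal
  set bK : Fin 2 → Fin 2 → Ω → ℝ := fun c c' ω =>
    pairMean Nbar (α ω) b c c' fun i j => (gK (Xs i ω, Xs j ω)).toReal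
  have hbL : Integrable bL P :=
    (integral_correctedMean hX hY hA hpos hXs hYs hAs hindep hident hNbar b
      (f := fun z => (gL z).toReal) hgLm.ennreal_toReal
      (integrable_toReal_of_lintegral_ne_top
        (hgLm.comp (hX.prodMk hY)).aemeasurable hgLtop.ne)).1
  have hbK : ∀ c c', Integrable (bK c c') P := fun c c' =>
    (integral_pairMean hX hY hA hpos hXs hYs hAs hindep hident Nbar b c c'
      (f := fun z => (gK z).toReal) hgKm.ennreal_toReal
      (integrable_toReal_of_lintegral_ne_top hgKm.aemeasurable
        (lintegral_featureLaw_prod_lt_top hX hY hA hpos hXs hYs hAs hindep hident hgKm hgK0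
          c c').ne)).1
  set R : EuclideanSpace ℝ (Fin m) → Ω → ℝ := fun ϑ ω =>
    batchRisk Nbar L h (fun i => Xs i ω) (fun i => Ys i ω) (fun i => As i ω) b ϑ
  set U : EuclideanSpace ℝ (Fin m) → Ω → ℝ := fun ϑ ω =>
    batchUnfairness Nbar K h (fun i => Xs i ω) (fun i => As i ω) b ϑ
  have hR := fun ϑ (hϑ : ϑ ∈ Θ) => integral_batchRisk hX hY hA hpos hXs hYs hAs hindep hident
    (hhm ϑ hϑ) hLm (hL_int ϑ hϑ) hNbar b
  have hU := fun ϑ (hϑ : ϑ ∈ Θ) => integral_batchUnfairness hX hY hA hpos hXs hYs hAs hindep hident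
    (hhm ϑ hϑ) hK hKm (hK_int ϑ hϑ) Nbar b
  have hlip : ∀ᵐ ω ∂P, ∀ ϑ ∈ B, |(R ϑ ω + lam * U ϑ ω) - (R θ ω + lam * U θ ω)| ≤
      (bL ω + lam * (bK 0 0 ω + bK 1 1 ω + 2 * bK 0 1 ω)) * ‖ϑ - θ‖ := by
    have hfinL : ∀ᵐ ω ∂P, ∀ i, gL (Xs i ω, Ys i ω) < ⊤ := ae_all_iff.2 fun i =>
      ae_lt_top (hgLm.comp ((hXs i).prodMk (hYs i))) ((hgLi i).trans_lt hgLtop).ne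
    filter_upwards [hfinL, ae_sample_pair_lt_top hX hY hA hXs hYs hAs hindep hident hgKm hgK0,
      ae_recurrentLabels_samples hpos hAs hindep hident] with ω h1 h2 h3 ϑ hϑ
    have hRle : |R ϑ ω - R θ ω| ≤ bL ω * ‖ϑ - θ‖ :=
      abs_correctedMean_sub_le Nbar (α ω) b fun i => hL_bound _ (h1 i).ne ϑ hϑ
    have hUle : ∀ c c', |pairMean Nbar (α ω) b c c' (fun i j => k ϑ (Xs i ω, Xs j ω)) -
        pairMean Nbar (α ω) b c c' (fun i j => k θ (Xs i ω, Xs j ω))| ≤ bK c c' ω * ‖ϑ - θ‖ :=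
      fun c c' => abs_pairMean_sub_le Nbar (α ω) b c c' fun i j hij =>
        hK_bound _ (h2 i j hij).ne ϑ hϑ
    have hUeq : ∀ ϑ, U ϑ ω = pairMean Nbar (α ω) b 0 0 (fun i j => k ϑ (Xs i ω, Xs j ω)) +
        pairMean Nbar (α ω) b 1 1 (fun i j => k ϑ (Xs i ω, Xs j ω)) -
        2 * pairMean Nbar (α ω) b 0 1 (fun i j => k ϑ (Xs i ω, Xs j ω)) := fun ϑ =>
      batchUnfairness_eq_pairMean Nbar K h (fun i => Xs i ω) h3 b ϑ
    have hUdiff : |U ϑ ω - U θ ω| ≤ (bK 0 0 ω + bK 1 1 ω + 2 * bK 0 1 ω) * ‖ϑ - θ‖ := by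
      rw [hUeq, hUeq]
      have e1 := abs_le.1 (hUle 0 0)
      have e2 := abs_le.1 (hUle 1 1)
      have e3 := abs_le.1 (hUle 0 1)
      rw [abs_le]
      constructor <;> linarith [e1.1, e1.2, e2.1, e2.2, e3.1, e3.2]
    calc |(R ϑ ω + lam * U ϑ ω) - (R θ ω + lam * U θ ω)|
        = |(R ϑ ω - R θ ω) + lam * (U ϑ ω - U θ ω)| := by congr 1; ring
      _ ≤ |R ϑ ω - R θ ω| + lam * |U ϑ ω - U θ ω| := by
        refine (abs_add_le _ _).trans_eq ?_
        rw [abs_mul, abs_of_nonneg hlam]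
      _ ≤ bL ω * ‖ϑ - θ‖ + lam * ((bK 0 0 ω + bK 1 1 ω + 2 * bK 0 1 ω) * ‖ϑ - θ‖) := by gcongr
      _ = _ := by ring
  have hmain := hasGradientAt_integral_of_lipschitz (P := P) (hBo.mem_nhds hθB)
    (F := fun ϑ ω => R ϑ ω + lam * U ϑ ω)
    (F' := fun ω => gradient (fun ϑ => R ϑ ω) θ + lam • gradient (fun ϑ => U ϑ ω) θ)
    (fun ϑ hϑ => (hR ϑ (hBΘ hϑ)).1.add ((hU ϑ (hBΘ hϑ)).1.const_mul lam)) hlip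
    (hbL.add ((((hbK 0 0).add (hbK 1 1)).add ((hbK 0 1).const_mul 2)).const_mul lam))
    (by
      filter_upwards [hd] with ω hω
      rw [hasGradientAt_iff_hasFDerivAt, map_add, map_smul]
      exact (hω.1.hasGradientAt.hasFDerivAt).add (hω.2.hasGradientAt.hasFDerivAt.const_mul lam))
  refine ⟨hmain.1, hmain.2.congr_of_eventuallyEq ?_⟩
  filter_upwards [hBo.mem_nhds hθB] with ϑ hϑ
  rw [integral_add (hR ϑ (hBΘ hϑ)).1 ((hU ϑ (hBΘ hϑ)).1.const_mul lam), integral_const_mul,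
    (hR ϑ (hBΘ hϑ)).2, (hU ϑ (hBΘ hϑ)).2]
  rfl
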